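/- **Theorem 1.** Let $\mathcal P=[p_l,p_h]$ with $0<p_l<p_h$. For every parameter $\beta=(\mathbf a,\mathbf b)\in\mathbb R^2\times\mathbb R^2$ in a parameter set $\Theta$ and every price $p\in\mathcal P$ let demand $D(p)$ and total claims $C(p)>0$ be square integrable, respectively integrable with $\log C(p)$ square integrable, with $$\mathbb E[D(p)]=h_1(a_0+a_1p),\quad \mathrm{Var}(D(p))=\sigma_1^2v_1(\mathbb E[D(p)]),\quad \mathbb E[\log C(p)]=h_2(b_0+b_1p),\quad \mathrm{Var}(\log C(p))=\sigma_2^2v_2(\mathbb E[\log C(p)]),$$ where $\sigma_1,\sigma_2>0$, each $h_k$ is twice continuously differentiable on $\mathbb R$, each $v_k$ is twice continuously differentiable on the range of $h_k$, and the links are canonical: $\dot h_k=v_k\circ h_k>0$. Let $r(p,\beta)=\mathbb E_\beta[pD(p)-C(p)]$ be the expected revenue, let $\beta_0$ be the true parameter, and let $V\subseteq\Theta$ be an open neighbourhood of $\beta_0$ such that for every $\beta\in V$ there is a unique maximizer $p(\beta)$ of $r(\cdot,\beta)$ over $\mathcal P$ (for $\beta\notin V$ let $p(\beta)\in\mathcal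 P$ be any price). Assume that $r$ is twice continuously differentiable on $\mathcal P\times V$ and that $\partial_pr(p^*,\beta_0)=0$ and $\partial_p^2r(p^*,\beta_0)<0$ at the optimal price $p^*=p(\beta_0)$ (one-sided derivatives if $p^*$ is an endpoint). Let the prices $p_1,p_2,\dots\in\mathcal P$ be chosen by a non-anticipating policy (for instance an adaptive GLM pricing algorithm): $p_t$ is known at time $t-1$ and, given the information up to time $t-1$, the observed demand and claims $(d_t,c_t)$ have the law of $(D(p_t),C(p_t))$ under $\beta_0$. Write $\mathbf p(t)=(1,p_t)^\top$ and $\mathbf p(\beta)=(1,p(\beta))^\top$, and let $\lambda_{\min}(t)$ be the smallest eigenvalue of $P_t=\sum_{i=1}^t\mathbf p(i)\mathbf p(i)^\top$. Let $\widehat\beta_t=(\widehat{\mathbf a}_t,\widehat{\mathbf b}_t)$ be maximum quasi-likelihood estimators (MQLE): whenever a solution $\theta=\mathbf a$ (with $y_i=d_i$ and $h_1,v_1,\sigma_1$) and a solution $\theta=\mathbf b$ (with $y_i=\log c_i$ and $h_2,v_2,\sigma_2$) of $$\sum_{i=1}^t\frac{\dot h(\mathbf p(i)^\top\theta)}{\sigma^2v(h(\mathbf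 p(i)^\top\theta))}\,\mathbf p(i)\,\bigl(y_i-h(\mathbf p(i)^\top\theta)\bigr)=0$$ exist, $\widehat{\mathbf a}_t$ and $\widehat{\mathbf b}_t$ are such solutions; when they do not, $\widehat\beta_t$ is arbitrary. Suppose the MQLE is strongly consistent, that is, almost surely $\widehat\beta_t$ is eventually a solution and $\widehat\beta_t\to\beta_0$. Suppose there are $t_0\in\mathbb N$, $c>0$ and $K$ such that, with $L_1(t)=c\sqrt{t\log t}$, 1. $\lambda_{\min}(t)\ge L_1(t)$ a.s. for all $t\ge t_0$, and 2. $\sum_{t=1}^T\|\mathbf p(t)-\mathbf p(\widehat\beta_t)\|^2\le K\,L_1(T)$ a.s. for all $T\ge t_0$. Then the cumulative regret $\mathrm{Regret}(T)=\mathbb E\bigl[\sum_{t=1}^T(r(p^*,\beta_0)-r(p_t,\beta_0))\bigr]$ (an integrable sum) satisfies, as $T\to\infty$, $$\mathrm{Regret}(T)=O\Bigl(L_1(T)+\sum_{t=2}^T\frac{\log t}{L_1(t)}\Bigr),\qquad L_1(T)+\sum_{t=2}^T\frac{\log t}{L_1(t)}=\Theta\bigl(\sqrt{T\log T}\bigr),$$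 and hence $\mathrm{Regret}(T)=O(\sqrt{T\log T})$. -/

import Mathlib

open MeasureTheory ProbabilityTheory Filter Topology Asymptotics
open scoped Matrix

noncomputable section

namespace GLMPricing

/-- The price vector `(1, p)`. -/
def priceVec (p : ℝ) : Fin 2 → ℝ := ![1, p]

/-- The design matrix `P_t = ∑_{i=1}^t (1, p_i) (1, p_i)ᵀ` of a price sequence. -/
def designMatrix (p : ℕ → ℝ) (t : ℕ) : Matrix (Fin 2) (Fin 2) ℝ :=
  ∑ i ∈ Finset.Icc 1 t, Matrix.vecMulVec (priceVec (p i)) (priceVec (p i))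

theorem designMatrix_isHermitian (p : ℕ → ℝ) (t : ℕ) : (designMatrix p t).IsHermitian := by
  unfold designMatrix Matrix.IsHermitian
  rw [Matrix.conjTranspose_sum]
  refine Finset.sum_congr rfl fun i _ => ?_
  ext j k
  simp [Matrix.vecMulVec_apply, mul_comm]

/-- The smallest eigenvalue `λ_min(t)` of the design matrix `P_t`. -/
def lambdaMin (p : ℕ → ℝ) (t : ℕ) : ℝ :=
  ⨅ i : Fin 2, (designMatrix_isHermitian p t).eigenvalues i

/-- The parameter `β = (a, b)`: `a` for the demand and `b` for the log-claims. -/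
abbrev Param : Type := (Fin 2 → ℝ) × (Fin 2 → ℝ)

/-- A link function `h` and a variance function `v` that are twice continuously differentiable,
with positive variance and canonical link: `h' = v ∘ h`. The variance function only matters on
the range of `h`. -/
structure IsCanonicalLink (h v : ℝ → ℝ) : Prop where
  contDiff_link : ContDiff ℝ 2 h
  contDiff_var : ContDiffOn ℝ 2 v (Set.range h)
  var_pos : ∀ x, 0 < v (h x)
  canonical : ∀ x, deriv h x = v (h x)

/-- The quasi-score
`l_t(θ) = ∑_{i=1}^t h'(x_iᵀθ) / (σ² v(h(x_iᵀθ))) · x_i · (y_i - h(x_iᵀθ))`, with `x_i = (1, p_i)`. -/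
def quasiScore (h v : ℝ → ℝ) (σ : ℝ) (p y : ℕ → ℝ) (t : ℕ) (θ : Fin 2 → ℝ) : Fin 2 → ℝ :=
  ∑ i ∈ Finset.Icc 1 t,
    (deriv h (priceVec (p i) ⬝ᵥ θ) / (σ ^ 2 * v (h (priceVec (p i) ⬝ᵥ θ)))
      * (y i - h (priceVec (p i) ⬝ᵥ θ))) • priceVec (p i)

/-- The real random variable `Y` on `(E, ν)` has finite second moment, mean `h x` and
variance `σ² v(mean)`. -/
structure HasGLMMoments {E : Type*} [MeasurableSpace E] (h v : ℝ → ℝ) (σ x : ℝ)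
    (Y : E → ℝ) (ν : Measure E) : Prop where
  memLp : MemLp Y 2 ν
  mean : ∫ z, Y z ∂ν = h x
  variance : ProbabilityTheory.variance Y ν = σ ^ 2 * v (∫ z, Y z ∂ν)

/-- The generalized linear pricing model: the interval `[pl, ph]` of acceptable prices, the link
and variance functions of demand (`1`) and log-claims (`2`), and, for each parameter `β` and price
`p`, the joint law `law β p` of (demand, total claims). The moment assumptions hold for every
parameter in the set `Θ` of admissible parameters. -/
structure Model where
  pl : ℝ
  ph : ℝ
  pl_pos : 0 < pl
  pl_lt_ph : pl < ph
  h₁ : ℝ → ℝ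
  v₁ : ℝ → ℝ
  h₂ : ℝ → ℝ
  v₂ : ℝ → ℝ
  link₁ : IsCanonicalLink h₁ v₁
  link₂ : IsCanonicalLink h₂ v₂
  σ₁ : ℝ
  σ₂ : ℝ
  σ₁_pos : 0 < σ₁
  σ₂_pos : 0 < σ₂
  Θ : Set Param
  law : Param → Kernel ℝ (ℝ × ℝ)
  isMarkov : ∀ β, IsMarkovKernel (law β)
  demand_moments : ∀ β ∈ Θ, ∀ p ∈ Set.Icc pl ph,
    HasGLMMoments h₁ v₁ σ₁ (priceVec p ⬝ᵥ β.1) (fun z : ℝ × ℝ => z.1) (law β p)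
  claims_pos : ∀ β ∈ Θ, ∀ p ∈ Set.Icc pl ph, ∀ᵐ z ∂(law β p), 0 < z.2
  claims_integrable : ∀ β ∈ Θ, ∀ p ∈ Set.Icc pl ph,
    Integrable (fun z : ℝ × ℝ => z.2) (law β p)
  logClaims_moments : ∀ β ∈ Θ, ∀ p ∈ Set.Icc pl ph,
    HasGLMMoments h₂ v₂ σ₂ (priceVec p ⬝ᵥ β.2) (fun z : ℝ × ℝ => Real.log z.2) (law β p)

namespace Model

variable (M : Model)

/-- The interval of acceptable prices. -/
def prices : Set ℝ := Set.Icc M.pl M.ph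

/-- The expected revenue `r(p, β) = E[p D(p) - C(p)]`. -/
def revenue (p : ℝ) (β : Param) : ℝ := ∫ z, (p * z.1 - z.2) ∂(M.law β p)

/-- The price `q` maximizes the expected revenue `r(·, β)` over the acceptable prices. -/
def IsOptimalPrice (β : Param) (q : ℝ) : Prop :=
  q ∈ M.prices ∧ ∀ p ∈ M.prices, M.revenue p β ≤ M.revenue q β

/-- The regularity assumptions on the revenue near the true parameter `β₀`. The function `popt` is
the certainty equivalent price `β ↦ p(β)`; outside `V` it may be any acceptable price. -/
structure RegularOptimum (V : Set Param) (β₀ : Param) (popt : Param → ℝ) : Prop where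
  isOpen : IsOpen V
  subset : V ⊆ M.Θ
  mem : β₀ ∈ V
  popt_mem : ∀ β, popt β ∈ M.prices
  popt_optimal : ∀ β ∈ V, M.IsOptimalPrice β (popt β)
  popt_unique : ∀ β ∈ V, ∀ q, M.IsOptimalPrice β q → q = popt β
  contDiffOn : ContDiffOn ℝ 2 (fun q : ℝ × Param => M.revenue q.1 q.2) (M.prices ×ˢ V)
  first_order : derivWithin (fun p => M.revenue p β₀) M.prices (popt β₀) = 0
  second_order : iteratedDerivWithin 2 (fun p => M.revenue p β₀) M.prices (popt β₀) < 0

/-- The parameter `β = (a, b)` solves the maximum quasi-likelihood equations at time `t` given the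
prices `p_i`, the demands `d_i` and the claims `c_i`, `1 ≤ i ≤ t`. -/
def IsMQLE (p d c : ℕ → ℝ) (t : ℕ) (β : Param) : Prop :=
  quasiScore M.h₁ M.v₁ M.σ₁ p d t β.1 = 0 ∧
  quasiScore M.h₂ M.v₂ M.σ₂ p (fun i => Real.log (c i)) t β.2 = 0

variable {Ω : Type*} [mΩ : MeasurableSpace Ω]

/-- The prices `p_t`, demands `d_t` and claims `c_t`, `t ≥ 1`, are generated by a non-anticipating
pricing policy under the true parameter `β₀`: the price `p_{t+1}` is acceptable and known at time
`t`, and, given the information up to time `t`, the pair `(d_{t+1}, c_{t+1})` is a fresh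
realisation of (demand, claims) at the price `p_{t+1}`. -/
structure IsNonAnticipating (μ : Measure Ω) (ℱ : Filtration ℕ mΩ) (β₀ : Param)
    (p d c : ℕ → Ω → ℝ) : Prop where
  price_mem : ∀ t ω, p (t + 1) ω ∈ M.prices
  price_measurable : ∀ t, Measurable[ℱ t] (p (t + 1))
  demand_measurable : ∀ t, Measurable[ℱ (t + 1)] (d (t + 1))
  claims_measurable : ∀ t, Measurable[ℱ (t + 1)] (c (t + 1))
  condLaw : ∀ t, ∀ A : Set Ω, MeasurableSet[ℱ t] A → ∀ B : Set (ℝ × ℝ), MeasurableSet B →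
    μ (A ∩ {ω | (d (t + 1) ω, c (t + 1) ω) ∈ B}) = ∫⁻ ω in A, M.law β₀ (p (t + 1) ω) B ∂μ

/-- `βhat` is a sequence of maximum quasi-likelihood estimators: almost surely, `βhat t` solves the
quasi-likelihood equations at every time `t ≥ 1` at which they have a solution. -/
def IsMQLESequence (μ : Measure Ω) (p d c : ℕ → Ω → ℝ) (βhat : ℕ → Ω → Param) : Prop :=
  ∀ᵐ ω ∂μ, ∀ t, 1 ≤ t →
    (∃ β, M.IsMQLE (fun i => p i ω) (fun i => d i ω) (fun i => c i ω) t β) →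
      M.IsMQLE (fun i => p i ω) (fun i => d i ω) (fun i => c i ω) t (βhat t ω)

/-- Strong consistency: almost surely, the estimators eventually exist and converge to `β₀`. -/
def StronglyConsistent (μ : Measure Ω) (p d c : ℕ → Ω → ℝ) (βhat : ℕ → Ω → Param)
    (β₀ : Param) : Prop :=
  ∀ᵐ ω ∂μ,
    (∀ᶠ t in atTop, M.IsMQLE (fun i => p i ω) (fun i => d i ω) (fun i => c i ω) t (βhat t ω)) ∧
    Tendsto (fun t => βhat t ω) atTop (𝓝 β₀)

/-- The cumulative regret `E[∑_{t=1}^T (r(p*) - r(p_t))]` at the true parameter `β₀`, with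
respect to the price `pstar`. -/
def regret (μ : Measure Ω) (β₀ : Param) (pstar : ℝ) (p : ℕ → Ω → ℝ) (T : ℕ) : ℝ :=
  ∫ ω, ∑ t ∈ Finset.Icc 1 T, (M.revenue pstar β₀ - M.revenue (p t ω) β₀) ∂μ

end Model

/-- The function `L₁(t) = c √(t log t)`. -/
def L₁ (c : ℝ) (t : ℕ) : ℝ := c * Real.sqrt (t * Real.log t)

end GLMPricing

end

/-! The loss at a single price is quadratic in its distance to the optimum, because the revenue is
`C²` and its derivative vanishes there. By `(x + y)² ≤ 2x² + 2y²` this distance splits into the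
deviation from the certainty equivalent price, which sums to at most `K L₁(T)`, and the error of
that price. The latter is Lipschitz in the estimation error near `β₀`
(`exists_lipschitz_maximizer`). Far from `β₀` it is merely bounded, so `min(ρ², ‖β̂_t - β₀‖²)`
controls it everywhere. It remains to show that the expectation of this truncated error is `O(log t
/ L₁(t))`.

For a canonical link the quasi-score is, up to a factor, minus the gradient of a convex function.
With noise vector `S_t = ∑ ε_i x_i` and `Q_t = S_tᵀ (I + P_t)⁻¹ S_t`, strong convexity on a ball of
radius `ρ` gives a root whose squared distance to the truth is at most a constant times `Q_t /
λ_min(t)`, unless `Q_t` is already of order `ρ² λ_min(t)`. Roots are unique, so the estimator obeys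
the truncated bound pathwise (`exists_mqle_error_bound`).

Finally `E Q_t = O(log t)`. When a term is added to `S_t`, the cross term has mean zero, and the
square term has mean at most a constant times `E[xᵀ (I + P_{t+1})⁻¹ x]`, which is at most the
expected increment of `log det (I + P_t)`. The sum telescopes, and the determinant grows
polynomially because prices are bounded (`integral_invForm_noise_le`). -/

noncomputable section

namespace GLMPricing

/-! ### Quadratic forms of the design matrix and of its regularized inverse -/

/-- The quadratic form `uᵀ P_t u` of the design matrix. -/
def designForm (p : ℕ → ℝ) (t : ℕ) (u : Fin 2 → ℝ) : ℝ :=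
  ∑ i ∈ Finset.Icc 1 t, (priceVec (p i) ⬝ᵥ u) ^ 2

theorem priceVec_dotProduct (x : ℝ) (u : Fin 2 → ℝ) : priceVec x ⬝ᵥ u = u 0 + x * u 1 := by
  simp [priceVec, dotProduct, Fin.sum_univ_two]

theorem sum_price_form (p : ℕ → ℝ) (t : ℕ) (u : Fin 2 → ℝ) :
    designForm p t u = t * u 0 ^ 2 + 2 * (∑ i ∈ Finset.Icc 1 t, p i) * (u 0 * u 1)
      + (∑ i ∈ Finset.Icc 1 t, p i ^ 2) * u 1 ^ 2 := by
  unfold designForm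
  rw [show (t : ℝ) * u 0 ^ 2 = ∑ i ∈ Finset.Icc 1 t, u 0 ^ 2 by simp, Finset.mul_sum,
    Finset.sum_mul, Finset.sum_mul, ← Finset.sum_add_distrib, ← Finset.sum_add_distrib]
  refine Finset.sum_congr rfl fun i _ => ?_
  rw [priceVec_dotProduct]
  ring

theorem designMatrix_eq (p : ℕ → ℝ) (t : ℕ) :
    designMatrix p t = !![(t : ℝ), ∑ i ∈ Finset.Icc 1 t, p i;
      ∑ i ∈ Finset.Icc 1 t, p i, ∑ i ∈ Finset.Icc 1 t, p i ^ 2] := by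
  ext i j
  fin_cases i <;> fin_cases j <;>
    simp [designMatrix, Matrix.sum_apply, priceVec, sq]

theorem quadratic_form_nonneg {a b d x y : ℝ} (htr : 0 ≤ a + d) (hdet : 0 ≤ a * d - b ^ 2) :
    0 ≤ a * x ^ 2 + 2 * b * (x * y) + d * y ^ 2 := by
  have ha : 0 ≤ a := by
    by_contra h
    push Not at h
    nlinarith [sq_nonneg b]
  have hd : 0 ≤ d := by
    by_contra h
    push Not at h
    nlinarith [sq_nonneg b]
  rcases ha.eq_or_lt with h | h
  · have hb : b = 0 := by
      rw [← h] at hdet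
      nlinarith [sq_nonneg b]
    subst hb
    rw [← h]
    have := mul_nonneg hd (sq_nonneg y)
    nlinarith
  -- Completing the square: `a` times the form is `(ax + by)² + (ad - b²) y²`.
  · have : 0 ≤ a * (a * x ^ 2 + 2 * b * (x * y) + d * y ^ 2) := by
      nlinarith [sq_nonneg (a * x + b * y), mul_nonneg hdet (sq_nonneg y)]
    exact nonneg_of_mul_nonneg_right this h

theorem lambdaMin_mul_le_designForm (p : ℕ → ℝ) (t : ℕ) (u : Fin 2 → ℝ) :
    lambdaMin p t * (u 0 ^ 2 + u 1 ^ 2) ≤ designForm p t u := by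
  have hH := designMatrix_isHermitian p t
  have htr := hH.trace_eq_sum_eigenvalues
  have hdet := hH.det_eq_prod_eigenvalues
  set e := hH.eigenvalues with he
  have hl : lambdaMin p t = min (e 0) (e 1) := by
    unfold lambdaMin
    rw [← he]
    apply le_antisymm
    · exact le_min (ciInf_le (Set.finite_range e).bddBelow 0) (ciInf_le (Set.finite_range e).bddBelow 1)
    · refine le_ciInf fun i => ?_
      fin_cases i <;> simp
  rw [designMatrix_eq] at htr hdet
  simp only [Matrix.trace_fin_two, Matrix.det_fin_two, Fin.sum_univ_two, Fin.prod_univ_two,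
    Matrix.of_apply, Matrix.cons_val', Matrix.cons_val_zero, Matrix.cons_val_one,
    RCLike.ofReal_real_eq_id, id_eq] at htr hdet
  rw [sum_price_form, hl]
  set B := ∑ i ∈ Finset.Icc 1 t, p i
  set D := ∑ i ∈ Finset.Icc 1 t, p i ^ 2
  -- `P_t - λ_min I` has nonnegative trace, and its determinant is the characteristic polynomial at
  -- an eigenvalue, hence zero.
  have key : 0 ≤ ((t : ℝ) - min (e 0) (e 1)) * u 0 ^ 2 + 2 * B * (u 0 * u 1)
      + (D - min (e 0) (e 1)) * u 1 ^ 2 := by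
    apply quadratic_form_nonneg
    · linarith [min_le_left (e 0) (e 1), min_le_right (e 0) (e 1)]
    · apply le_of_eq
      rcases min_choice (e 0) (e 1) with h | h <;> rw [h]
      · linear_combination e 0 * htr - hdet
      · linear_combination e 1 * htr - hdet
  linarith

/-- The squared norm `Sᵀ (I + P_t)⁻¹ S`, written out in coordinates. -/
def invForm (p : ℕ → ℝ) (t : ℕ) (s : Fin 2 → ℝ) : ℝ :=
  ((1 + ∑ i ∈ Finset.Icc 1 t, p i ^ 2) * s 0 ^ 2 - 2 * (∑ i ∈ Finset.Icc 1 t, p i) * (s 0 * s 1)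
    + (1 + t) * s 1 ^ 2) /
  ((1 + t) * (1 + ∑ i ∈ Finset.Icc 1 t, p i ^ 2) - (∑ i ∈ Finset.Icc 1 t, p i) ^ 2)

/-- The determinant of `I + P_t`. -/
def regDet (p : ℕ → ℝ) (t : ℕ) : ℝ :=
  (1 + t) * (1 + ∑ i ∈ Finset.Icc 1 t, p i ^ 2) - (∑ i ∈ Finset.Icc 1 t, p i) ^ 2

theorem sum_sq_le (p : ℕ → ℝ) (t : ℕ) :
    (∑ i ∈ Finset.Icc 1 t, p i) ^ 2 ≤ t * ∑ i ∈ Finset.Icc 1 t, p i ^ 2 := by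
  have := sq_sum_le_card_mul_sum_sq (s := Finset.Icc 1 t) (f := p)
  simpa using this

theorem one_le_regDet (p : ℕ → ℝ) (t : ℕ) : 1 ≤ regDet p t := by
  have h1 := sum_sq_le p t
  have h2 : 0 ≤ ∑ i ∈ Finset.Icc 1 t, p i ^ 2 := Finset.sum_nonneg fun i _ => sq_nonneg _
  have h3 : (0 : ℝ) ≤ t := Nat.cast_nonneg t
  unfold regDet
  nlinarith

/-- Cauchy–Schwarz for the inner product of `A = I + P_t`. In dimension two the defect is the
squared cross product of `A u` and `s`, divided by `det A`. -/
theorem sq_dotProduct_le_invForm (p : ℕ → ℝ) (t : ℕ) (s u : Fin 2 → ℝ) :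
    (s 0 * u 0 + s 1 * u 1) ^ 2 ≤ invForm p t s * (u 0 ^ 2 + u 1 ^ 2 + designForm p t u) := by
  have h := one_le_regDet p t
  unfold regDet at h
  rw [invForm, sum_price_form, div_mul_eq_mul_div, le_div_iff₀ (by linarith)]
  set B := ∑ i ∈ Finset.Icc 1 t, p i
  set D := ∑ i ∈ Finset.Icc 1 t, p i ^ 2
  have := sq_nonneg (((1 + t) * u 0 + B * u 1) * s 1 - (B * u 0 + (1 + D) * u 1) * s 0)
  nlinarith

theorem invForm_nonneg (p : ℕ → ℝ) (t : ℕ) (s : Fin 2 → ℝ) : 0 ≤ invForm p t s := by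
  by_cases hs : s 0 = 0 ∧ s 1 = 0
  · simp [invForm, hs.1, hs.2]
  · have h := sq_dotProduct_le_invForm p t s s
    have h0 : 0 < s 0 * s 0 + s 1 * s 1 := by
      rcases not_and_or.mp hs with h | h
      · nlinarith [mul_self_pos.mpr h, mul_self_nonneg (s 1)]
      · nlinarith [mul_self_pos.mpr h, mul_self_nonneg (s 0)]
    have h1 : 0 < s 0 ^ 2 + s 1 ^ 2 + designForm p t s := by
      have : 0 ≤ designForm p t s := Finset.sum_nonneg fun i _ => sq_nonneg _
      nlinarith
    by_contra hn
    push Not at hn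
    nlinarith [mul_pos_of_neg_of_neg hn (neg_lt_zero.mpr h1), pow_pos h0 2]

theorem invForm_le (p : ℕ → ℝ) (t : ℕ) (s : Fin 2 → ℝ) : invForm p t s ≤ s 0 ^ 2 + s 1 ^ 2 := by
  have h := one_le_regDet p t
  unfold regDet at h
  have h1 := sum_sq_le p t
  rw [invForm, div_le_iff₀ (by linarith)]
  set B := ∑ i ∈ Finset.Icc 1 t, p i
  set D := ∑ i ∈ Finset.Icc 1 t, p i ^ 2 with hD
  have hD0 : 0 ≤ D := Finset.sum_nonneg fun i _ => sq_nonneg _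
  have ht : (0 : ℝ) ≤ t := Nat.cast_nonneg t
  have := quadratic_form_nonneg (a := (t : ℝ)) (b := B) (d := D) (x := s 0) (y := s 1)
    (by linarith) (by linarith)
  nlinarith [mul_nonneg (sub_nonneg.mpr h1) (add_nonneg (sq_nonneg (s 0)) (sq_nonneg (s 1)))]

/-- The matrix determinant lemma: `det(A - xxᵀ) = det A · (1 - xᵀA⁻¹x)` with `A = I + P_{t+1}`. -/
theorem invForm_priceVec (p : ℕ → ℝ) (t : ℕ) :
    invForm p (t + 1) (priceVec (p (t + 1))) = 1 - regDet p t / regDet p (t + 1) := by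
  have h := one_le_regDet p (t + 1)
  rw [eq_sub_iff_add_eq, invForm, ← regDet, ← add_div, div_eq_one_iff_eq (by linarith), regDet,
    regDet, Finset.sum_Icc_succ_top (by omega), Finset.sum_Icc_succ_top (by omega)]
  simp [priceVec]
  ring

/-- Adding `xxᵀ` to a positive definite matrix shrinks its inverse. As in the Sherman–Morrison
formula, the difference is a square, here that of `xᵀ adj(A) s` with `A = I + P_t`. -/
theorem invForm_succ_le (p : ℕ → ℝ) (t : ℕ) (s : Fin 2 → ℝ) :
    invForm p (t + 1) s ≤ invForm p t s := by
  have h := one_le_regDet p t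
  have h' := one_le_regDet p (t + 1)
  unfold regDet at h h'
  rw [invForm, invForm, div_le_div_iff₀ (by linarith) (by linarith)]
  rw [Finset.sum_Icc_succ_top (by omega), Finset.sum_Icc_succ_top (by omega)]
  set B := ∑ i ∈ Finset.Icc 1 t, p i
  set D := ∑ i ∈ Finset.Icc 1 t, p i ^ 2
  set x := p (t + 1)
  push_cast
  have := sq_nonneg (((1 + D) - B * x) * s 0 + ((1 + t) * x - B) * s 1)
  nlinarith

/-- The bilinear form `sᵀ (I + P_t)⁻¹ r`, written out in coordinates. -/
def invBilin (p : ℕ → ℝ) (t : ℕ) (s r : Fin 2 → ℝ) : ℝ :=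
  ((1 + ∑ i ∈ Finset.Icc 1 t, p i ^ 2) * (s 0 * r 0)
    - (∑ i ∈ Finset.Icc 1 t, p i) * (s 0 * r 1 + s 1 * r 0) + (1 + t) * (s 1 * r 1)) /
  ((1 + t) * (1 + ∑ i ∈ Finset.Icc 1 t, p i ^ 2) - (∑ i ∈ Finset.Icc 1 t, p i) ^ 2)

theorem invForm_add_smul (p : ℕ → ℝ) (t : ℕ) (s r : Fin 2 → ℝ) (e : ℝ) :
    invForm p t (s + e • r) = invForm p t s + 2 * (invBilin p t s r * e) + invForm p t r * e ^ 2 := by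
  unfold invForm invBilin
  simp only [Pi.add_apply, Pi.smul_apply, smul_eq_mul]
  ring

theorem sq_invBilin_le (p : ℕ → ℝ) (t : ℕ) (s r : Fin 2 → ℝ) :
    invBilin p t s r ^ 2 ≤ invForm p t s * invForm p t r := by
  have := discrim_le_zero (a := invForm p t r) (b := 2 * invBilin p t s r) (c := invForm p t s)
    fun e => by
      have := invForm_nonneg p t (s + e • r)
      rw [invForm_add_smul] at this
      linarith
  unfold discrim at this
  linarith

theorem regDet_zero (p : ℕ → ℝ) : regDet p 0 = 1 := by simp [regDet]

/-- `1 - z ≤ -log z` at the ratio of consecutive determinants. The right-hand sides telescope over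
time, which is the source of the logarithm in the rate. -/
theorem invForm_priceVec_le_log (p : ℕ → ℝ) (t : ℕ) :
    invForm p (t + 1) (priceVec (p (t + 1)))
      ≤ Real.log (regDet p (t + 1)) - Real.log (regDet p t) := by
  have h := one_le_regDet p t
  have h' := one_le_regDet p (t + 1)
  rw [invForm_priceVec]
  have := Real.log_le_sub_one_of_pos (x := regDet p t / regDet p (t + 1))
    (div_pos (by linarith) (by linarith))
  rw [Real.log_div (by linarith) (by linarith)] at this
  linarith

theorem regDet_le {p : ℕ → ℝ} {t : ℕ} {b : ℝ} (hp : ∀ i ∈ Finset.Icc 1 t, p i ^ 2 ≤ b)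
    (hb : 0 ≤ b) : regDet p t ≤ ((1 + b) * (1 + t)) ^ 2 := by
  have h : ∑ i ∈ Finset.Icc 1 t, p i ^ 2 ≤ t * b := by
    simpa using Finset.sum_le_card_nsmul _ _ _ hp
  have ht : (0 : ℝ) ≤ t := Nat.cast_nonneg t
  unfold regDet
  have h1 : (1 + t : ℝ) * (1 + ∑ i ∈ Finset.Icc 1 t, p i ^ 2) ≤ (1 + t) * (1 + t * b) := by gcongr
  have h2 : (1 + t : ℝ) * (1 + t * b) ≤ (1 + t) * ((1 + t) * (1 + b)) := by
    gcongr
    nlinarith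
  have h3 : (1 + t : ℝ) * ((1 + t) * (1 + b)) ≤ ((1 + b) * (1 + t)) ^ 2 := by
    have : 0 ≤ b * (1 + b) * (1 + t : ℝ) ^ 2 := by positivity
    nlinarith
  nlinarith [sq_nonneg (∑ i ∈ Finset.Icc 1 t, p i)]

/-! ### Quasi-likelihood equations: existence, location and uniqueness of the root -/

/-- Strong convexity on a segment: `h - κz`, the derivative of `H - κz²/2`, is monotone there, and
the mean value theorem applies in either orientation of the segment. -/
theorem taylor_lower_bound {H h : ℝ → ℝ} {κ x y : ℝ} (hH : ∀ z, HasDerivAt H (h z) z)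
    (hh : Differentiable ℝ h) (hκ : ∀ z ∈ segment ℝ x y, κ ≤ deriv h z) :
    h x * (y - x) + κ / 2 * (y - x) ^ 2 ≤ H y - H x := by
  have hmono : MonotoneOn (fun z => h z - κ * z) (segment ℝ x y) := by
    have hd : ∀ z, HasDerivAt (fun z => h z - κ * z) (deriv h z - κ) z := fun z =>
      (hh z).hasDerivAt.sub (by simpa using (hasDerivAt_id z).const_mul κ)
    apply monotoneOn_of_deriv_nonneg (convex_segment x y)
    · exact fun z _ => (hd z).continuousAt.continuousWithinAt
    · exact fun z _ => (hd z).differentiableAt.differentiableWithinAt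
    · intro z hz
      rw [(hd z).deriv]
      linarith [hκ z (interior_subset hz)]
  have hd : ∀ z, HasDerivAt (fun z => H z - κ / 2 * z ^ 2) (h z - κ * z) z := fun z =>
    ((hH z).sub ((hasDerivAt_pow 2 z).const_mul (κ / 2))).congr_deriv (by push_cast; ring)
  have hc : Continuous fun z => H z - κ / 2 * z ^ 2 :=
    continuous_iff_continuousAt.mpr fun z => (hd z).continuousAt
  rcases lt_trichotomy x y with hxy | hxy | hxy
  · obtain ⟨z, hz, hz'⟩ := exists_hasDerivAt_eq_slope _ _ hxy hc.continuousOn fun z _ => hd z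
    rw [eq_div_iff (by linarith)] at hz'
    have := hmono (left_mem_segment ℝ x y)
      (by rw [segment_eq_Icc hxy.le]; exact Set.Ioo_subset_Icc_self hz) hz.1.le
    have := mul_le_mul_of_nonneg_right this (sub_nonneg.mpr hxy.le)
    dsimp only at this
    nlinarith
  · subst hxy
    simp
  · obtain ⟨z, hz, hz'⟩ := exists_hasDerivAt_eq_slope _ _ hxy hc.continuousOn fun z _ => hd z
    rw [eq_div_iff (by linarith)] at hz'
    have := hmono
      (by rw [segment_symm, segment_eq_Icc hxy.le]; exact Set.Ioo_subset_Icc_self hz)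
      (left_mem_segment ℝ x y) hz.2.le
    have := mul_le_mul_of_nonneg_right this (sub_nonneg.mpr hxy.le)
    dsimp only at this
    nlinarith

theorem continuous_priceVec_dotProduct :
    Continuous fun q : ℝ × (Fin 2 → ℝ) => priceVec q.1 ⬝ᵥ q.2 := by
  simp only [priceVec_dotProduct]
  fun_prop

/-- On a compact set of prices and parameters the derivative of the link is bounded below. -/
theorem exists_pos_le_deriv_link {h : ℝ → ℝ} (hh : ContDiff ℝ 2 h) (hpos : ∀ x, 0 < deriv h x)
    (a b : ℝ) (θ₀ : Fin 2 → ℝ) (ρ : ℝ) :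
    ∃ κ > 0, ∀ x ∈ Set.Icc a b, ∀ θ ∈ Metric.closedBall θ₀ ρ,
      κ ≤ deriv h (priceVec x ⬝ᵥ θ) := by
  have hc : Continuous fun q : ℝ × (Fin 2 → ℝ) => deriv h (priceVec q.1 ⬝ᵥ q.2) :=
    (hh.continuous_deriv (by norm_num)).comp continuous_priceVec_dotProduct
  obtain ⟨κ, hκ, hle⟩ := (isCompact_Icc.prod (isCompact_closedBall θ₀ ρ)).exists_forall_le'
    (s := Set.Icc a b ×ˢ Metric.closedBall θ₀ ρ) hc.continuousOn fun q _ => hpos _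
  exact ⟨κ, hκ, fun x hx θ hθ => hle (x, θ) ⟨hx, hθ⟩⟩

theorem norm_sq_le_sum_sq (u : Fin 2 → ℝ) : ‖u‖ ^ 2 ≤ u 0 ^ 2 + u 1 ^ 2 := by
  have : ‖u‖ ≤ Real.sqrt (u 0 ^ 2 + u 1 ^ 2) := by
    rw [pi_norm_le_iff_of_nonneg (Real.sqrt_nonneg _)]
    intro i
    apply Real.le_sqrt_of_sq_le
    rw [Real.norm_eq_abs, sq_abs]
    fin_cases i <;> simp <;> positivity
  calc ‖u‖ ^ 2 ≤ Real.sqrt (u 0 ^ 2 + u 1 ^ 2) ^ 2 := by gcongr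
    _ = _ := Real.sq_sqrt (by positivity)

/-- If the weighted noise is small compared to the smallest eigenvalue of the design matrix, then
the quasi-likelihood equations have a solution close to the true parameter. -/
theorem exists_score_eq_zero {h : ℝ → ℝ} (hh : ContDiff ℝ 2 h) {κ ρ : ℝ} (hκ : 0 < κ)
    (hρ : 0 < ρ) {θ₀ : Fin 2 → ℝ} {p : ℕ → ℝ} (y : ℕ → ℝ) {t : ℕ}
    (hle : ∀ i ∈ Finset.Icc 1 t, ∀ θ ∈ Metric.closedBall θ₀ ρ,
      κ ≤ deriv h (priceVec (p i) ⬝ᵥ θ))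
    (hl : 1 ≤ lambdaMin p t)
    (hsmall : 8 * invForm p t
        (∑ i ∈ Finset.Icc 1 t, (y i - h (priceVec (p i) ⬝ᵥ θ₀)) • priceVec (p i))
      < κ ^ 2 * lambdaMin p t * ρ ^ 2) :
    ∃ θ, ∑ i ∈ Finset.Icc 1 t, (y i - h (priceVec (p i) ⬝ᵥ θ)) • priceVec (p i) = 0 ∧
      κ ^ 2 * lambdaMin p t * ‖θ - θ₀‖ ^ 2 ≤ 8 * invForm p t
        (∑ i ∈ Finset.Icc 1 t, (y i - h (priceVec (p i) ⬝ᵥ θ₀)) • priceVec (p i)) := by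
  set S := ∑ i ∈ Finset.Icc 1 t, (y i - h (priceVec (p i) ⬝ᵥ θ₀)) • priceVec (p i) with hS
  set Q := invForm p t S
  set H : ℝ → ℝ := fun x => ∫ z in (0 : ℝ)..x, h z
  have hH : ∀ z, HasDerivAt H (h z) z := fun z =>
    intervalIntegral.integral_hasDerivAt_right (hh.continuous.intervalIntegrable _ _)
      hh.continuous.aestronglyMeasurable.stronglyMeasurableAtFilter hh.continuous.continuousAt
  have hHc : Continuous H := continuous_iff_continuousAt.mpr fun z => (hH z).continuousAt
  -- `F` is the negative quasi-log-likelihood up to scale: its gradient is minus the sum that has to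
  -- vanish. It is minimized over the closed ball.
  set F : (Fin 2 → ℝ) → ℝ := fun θ =>
    ∑ i ∈ Finset.Icc 1 t, (H (priceVec (p i) ⬝ᵥ θ) - y i * (priceVec (p i) ⬝ᵥ θ)) with hF
  have hFc : Continuous F := by
    refine continuous_finsetSum _ fun i _ => ?_
    have : Continuous fun θ => priceVec (p i) ⬝ᵥ θ :=
      continuous_priceVec_dotProduct.comp (Continuous.prodMk_right (p i))
    exact (hHc.comp this).sub (this.const_mul _)
  obtain ⟨θ, hθ, hmin⟩ := (isCompact_closedBall θ₀ ρ).exists_isMinOn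
    ⟨θ₀, Metric.mem_closedBall_self hρ.le⟩ hFc.continuousOn
  have hlow : κ / 2 * designForm p t (θ - θ₀) - (S 0 * (θ - θ₀) 0 + S 1 * (θ - θ₀) 1)
      ≤ F θ - F θ₀ := by
    have e1 : S 0 * (θ - θ₀) 0 + S 1 * (θ - θ₀) 1 = ∑ i ∈ Finset.Icc 1 t,
        (y i - h (priceVec (p i) ⬝ᵥ θ₀)) * (priceVec (p i) ⬝ᵥ (θ - θ₀)) := by
      rw [hS, Finset.sum_apply, Finset.sum_apply, Finset.sum_mul, Finset.sum_mul,
        ← Finset.sum_add_distrib]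
      refine Finset.sum_congr rfl fun i _ => ?_
      rw [priceVec_dotProduct _ (θ - θ₀)]
      simp [priceVec]
      ring
    rw [e1, designForm, Finset.mul_sum, ← Finset.sum_sub_distrib, hF, ← Finset.sum_sub_distrib]
    refine Finset.sum_le_sum fun i hi => ?_
    have hseg : ∀ z ∈ segment ℝ (priceVec (p i) ⬝ᵥ θ₀) (priceVec (p i) ⬝ᵥ θ),
        κ ≤ deriv h z := by
      rintro z ⟨a, b, ha, hb, hab, rfl⟩
      have := hle i hi (a • θ₀ + b • θ)
        (convex_closedBall θ₀ ρ (Metric.mem_closedBall_self hρ.le) hθ ha hb hab)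
      simpa [dotProduct_add, dotProduct_smul] using this
    have := taylor_lower_bound hH (hh.differentiable (by norm_num)) hseg
    rw [dotProduct_sub]
    linarith
  have hle0 : F θ ≤ F θ₀ := hmin (Metric.mem_closedBall_self hρ.le)
  have hQ0 : 0 ≤ Q := invForm_nonneg _ _ _
  have hbound : κ ^ 2 * lambdaMin p t * ‖θ - θ₀‖ ^ 2 ≤ 8 * Q := by
    set G := designForm p t (θ - θ₀)
    have hlam := lambdaMin_mul_le_designForm p t (θ - θ₀)
    have hn := norm_sq_le_sum_sq (θ - θ₀)
    have hcs := sq_dotProduct_le_invForm p t S (θ - θ₀)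
    set N := (θ - θ₀) 0 ^ 2 + (θ - θ₀) 1 ^ 2
    have hN : 0 ≤ N := by positivity
    -- As `λ_min ≥ 1`, the identity in `I + P_t` costs only a factor two. Minimality then gives
    -- `(κG/2)² ≤ Q(N + G) ≤ 2QG`, whence the constant 8.
    have hNG : N ≤ G := by nlinarith
    have hG : κ ^ 2 * G ≤ 8 * Q := by
      rcases (hN.trans hNG).eq_or_lt with h0 | h0
      · rw [← h0]; linarith
      · have h1 : (κ / 2 * G) ^ 2 ≤ Q * (N + G) := by
          refine le_trans ?_ hcs
          have : 0 ≤ κ / 2 * G := by positivity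
          gcongr
          linarith
        have h2 : Q * (N + G) ≤ Q * (2 * G) := by gcongr; linarith
        have h3 : (κ ^ 2 * G) * G ≤ (8 * Q) * G := by nlinarith
        exact le_of_mul_le_mul_right h3 h0
    calc κ ^ 2 * lambdaMin p t * ‖θ - θ₀‖ ^ 2 ≤ κ ^ 2 * lambdaMin p t * N := by gcongr
      _ = κ ^ 2 * (lambdaMin p t * N) := by ring
      _ ≤ κ ^ 2 * G := by gcongr
      _ ≤ 8 * Q := hG
  -- Small noise keeps the minimizer off the sphere, so it is an unconstrained local minimum and
  -- every partial derivative vanishes.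
  have hint : ‖θ - θ₀‖ < ρ := by
    have : κ ^ 2 * lambdaMin p t * ‖θ - θ₀‖ ^ 2 < κ ^ 2 * lambdaMin p t * ρ ^ 2 :=
      hbound.trans_lt hsmall
    exact lt_of_pow_lt_pow_left₀ 2 hρ.le (lt_of_mul_lt_mul_left this (by positivity))
  refine ⟨θ, ?_, hbound⟩
  have hloc : IsLocalMin F θ :=
    hmin.isLocalMin (Metric.closedBall_mem_nhds_of_mem (by simpa [dist_eq_norm] using hint))
  ext j
  set e : Fin 2 → ℝ := Pi.single j 1
  have hcurve : IsLocalMin (fun s : ℝ => F (θ + s • e)) 0 := by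
    have ht : Tendsto (fun s : ℝ => θ + s • e) (𝓝 0) (𝓝 θ) := by
      have : Continuous fun s : ℝ => θ + s • e := by fun_prop
      simpa using this.tendsto 0
    have := ht.eventually hloc
    simpa [IsLocalMin, IsMinFilter] using this
  have hderiv : HasDerivAt (fun s : ℝ => F (θ + s • e))
      (∑ i ∈ Finset.Icc 1 t, (h (priceVec (p i) ⬝ᵥ θ) - y i) * priceVec (p i) j) 0 := by
    refine HasDerivAt.fun_sum fun i _ => ?_
    have hx : HasDerivAt (fun s : ℝ => priceVec (p i) ⬝ᵥ (θ + s • e)) (priceVec (p i) j) 0 := by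
      have : (fun s : ℝ => priceVec (p i) ⬝ᵥ (θ + s • e))
          = fun s => priceVec (p i) ⬝ᵥ θ + s * priceVec (p i) j := by
        funext s
        simp [dotProduct_add, dotProduct_smul, e]
      rw [this]
      simpa using ((hasDerivAt_id (0 : ℝ)).mul_const (priceVec (p i) j)).const_add
        (priceVec (p i) ⬝ᵥ θ)
    have hcomp : HasDerivAt (fun s : ℝ => H (priceVec (p i) ⬝ᵥ (θ + s • e)))
        (h (priceVec (p i) ⬝ᵥ θ) * priceVec (p i) j) 0 := by
      have h0 := hH (priceVec (p i) ⬝ᵥ (θ + (0 : ℝ) • e))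
      have := h0.comp (0 : ℝ) hx
      rwa [zero_smul, add_zero] at this
    rw [sub_mul]
    exact hcomp.sub (hx.const_mul (y i))
  have h0 := hcurve.hasDerivAt_eq_zero hderiv
  rw [Finset.sum_apply, Pi.zero_apply, ← neg_eq_zero, ← h0, ← Finset.sum_neg_distrib]
  refine Finset.sum_congr rfl fun i _ => ?_
  simp only [Pi.smul_apply, smul_eq_mul]
  ring

/-- The quasi-likelihood equations have at most one solution when the design matrix is positive
definite. -/
theorem score_unique {h : ℝ → ℝ} (hmono : StrictMono h) {p : ℕ → ℝ} {y : ℕ → ℝ} {t : ℕ}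
    (hl : 0 < lambdaMin p t) {θ θ' : Fin 2 → ℝ}
    (h1 : ∑ i ∈ Finset.Icc 1 t, (y i - h (priceVec (p i) ⬝ᵥ θ)) • priceVec (p i) = 0)
    (h2 : ∑ i ∈ Finset.Icc 1 t, (y i - h (priceVec (p i) ⬝ᵥ θ')) • priceVec (p i) = 0) :
    θ = θ' := by
  -- Pairing the difference of the two equations with `θ - θ'` gives a zero sum of terms that are
  -- nonnegative by monotonicity of `h`, so each term vanishes.
  have hsum : ∑ i ∈ Finset.Icc 1 t, (h (priceVec (p i) ⬝ᵥ θ) - h (priceVec (p i) ⬝ᵥ θ'))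
      * (priceVec (p i) ⬝ᵥ θ - priceVec (p i) ⬝ᵥ θ') = 0 := by
    have h3 := congrArg (fun s : Fin 2 → ℝ => s ⬝ᵥ (θ - θ')) (h2.trans h1.symm)
    simp only [sum_dotProduct, smul_dotProduct, smul_eq_mul] at h3
    rw [← sub_eq_zero, ← Finset.sum_sub_distrib] at h3
    rw [← h3]
    refine Finset.sum_congr rfl fun i _ => ?_
    rw [dotProduct_sub]
    ring
  have hnn : ∀ a b : ℝ, 0 ≤ (h a - h b) * (a - b) := fun a b => by
    rcases le_total a b with hab | hab
    · exact mul_nonneg_of_nonpos_of_nonpos (sub_nonpos.mpr (hmono.monotone hab))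
        (sub_nonpos.mpr hab)
    · exact mul_nonneg (sub_nonneg.mpr (hmono.monotone hab)) (sub_nonneg.mpr hab)
  rw [Finset.sum_eq_zero_iff_of_nonneg fun i _ => hnn _ _] at hsum
  have hform : designForm p t (θ - θ') = 0 := by
    refine Finset.sum_eq_zero fun i hi => ?_
    rw [dotProduct_sub]
    rcases mul_eq_zero.mp (hsum i hi) with h0 | h0
    · rw [hmono.injective (sub_eq_zero.mp h0)]
      simp
    · rw [h0]
      simp
  have hlam := lambdaMin_mul_le_designForm p t (θ - θ')
  rw [hform] at hlam
  have hn := norm_sq_le_sum_sq (θ - θ')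
  have : ‖θ - θ'‖ ^ 2 ≤ 0 := hn.trans (nonpos_of_mul_nonpos_right hlam hl)
  have : ‖θ - θ'‖ = 0 := by
    rw [← sq_eq_zero_iff]
    exact le_antisymm this (sq_nonneg _)
  exact sub_eq_zero.mp (norm_eq_zero.mp this)

theorem IsCanonicalLink.deriv_pos {h v : ℝ → ℝ} (hl : IsCanonicalLink h v) (x : ℝ) :
    0 < deriv h x := by
  rw [hl.canonical]
  exact hl.var_pos x

/-- Since `h' = v ∘ h`, the weight `h' / (σ² v)` is the constant `σ⁻²`. -/
theorem quasiScore_eq_zero_iff {h v : ℝ → ℝ} (hl : IsCanonicalLink h v) {σ : ℝ} (hσ : 0 < σ)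
    (p y : ℕ → ℝ) (t : ℕ) (θ : Fin 2 → ℝ) :
    quasiScore h v σ p y t θ = 0 ↔
      ∑ i ∈ Finset.Icc 1 t, (y i - h (priceVec (p i) ⬝ᵥ θ)) • priceVec (p i) = 0 := by
  have : quasiScore h v σ p y t θ = (σ ^ 2)⁻¹ •
      ∑ i ∈ Finset.Icc 1 t, (y i - h (priceVec (p i) ⬝ᵥ θ)) • priceVec (p i) := by
    rw [quasiScore, Finset.smul_sum]
    refine Finset.sum_congr rfl fun i _ => ?_
    have hv := (hl.var_pos (priceVec (p i) ⬝ᵥ θ)).ne'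
    rw [hl.canonical, smul_smul]
    congr 2
    field_simp
  rw [this, smul_eq_zero_iff_right (by positivity)]

/-- The noise vector `∑_{i ≤ t} (y_i - h(x_iᵀθ₀)) x_i`. -/
def noise (h : ℝ → ℝ) (θ₀ : Fin 2 → ℝ) (p y : ℕ → ℝ) (t : ℕ) : Fin 2 → ℝ :=
  ∑ i ∈ Finset.Icc 1 t, (y i - h (priceVec (p i) ⬝ᵥ θ₀)) • priceVec (p i)

/-- Deterministic error bound for maximum quasi-likelihood estimators. -/
theorem Model.exists_mqle_error_bound (M : Model) (β₀ : Param) {ρ : ℝ} (hρ : 0 < ρ) :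
    ∃ C, 0 < C ∧ ∀ (p d c : ℕ → ℝ) (t : ℕ) (β : Param),
      (∀ i ∈ Finset.Icc 1 t, p i ∈ M.prices) → 1 ≤ lambdaMin p t →
      ((∃ β, M.IsMQLE p d c t β) → M.IsMQLE p d c t β) →
      min (ρ ^ 2) (‖β - β₀‖ ^ 2) * lambdaMin p t ≤
        C * (invForm p t (noise M.h₁ β₀.1 p d t)
          + invForm p t (noise M.h₂ β₀.2 p (fun i => Real.log (c i)) t)) := by
  obtain ⟨κ₁, hκ₁, hle₁⟩ := exists_pos_le_deriv_link M.link₁.contDiff_link M.link₁.deriv_pos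
    M.pl M.ph β₀.1 ρ
  obtain ⟨κ₂, hκ₂, hle₂⟩ := exists_pos_le_deriv_link M.link₂.contDiff_link M.link₂.deriv_pos
    M.pl M.ph β₀.2 ρ
  refine ⟨8 / κ₁ ^ 2 + 8 / κ₂ ^ 2, by positivity, fun p d c t β hp hl hβ => ?_⟩
  set Q₁ := invForm p t (noise M.h₁ β₀.1 p d t) with hQ₁
  set Q₂ := invForm p t (noise M.h₂ β₀.2 p (fun i => Real.log (c i)) t) with hQ₂
  have hQ₁0 : 0 ≤ Q₁ := invForm_nonneg _ _ _
  have hQ₂0 : 0 ≤ Q₂ := invForm_nonneg _ _ _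
  have hb₁ : 8 / κ₁ ^ 2 * Q₁ ≤ (8 / κ₁ ^ 2 + 8 / κ₂ ^ 2) * (Q₁ + Q₂) := by
    gcongr
    · exact le_add_of_nonneg_right (by positivity)
    · linarith
  have hb₂ : 8 / κ₂ ^ 2 * Q₂ ≤ (8 / κ₁ ^ 2 + 8 / κ₂ ^ 2) * (Q₁ + Q₂) := by
    gcongr
    · exact le_add_of_nonneg_left (by positivity)
    · linarith
  have hdiv : ∀ {κ Q x : ℝ}, 0 < κ → κ ^ 2 * lambdaMin p t * x ≤ 8 * Q →
      x * lambdaMin p t ≤ 8 / κ ^ 2 * Q := fun {κ Q x} hκ h => by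
    rw [div_mul_eq_mul_div, le_div_iff₀ (by positivity)]
    linarith
  have hl0 : 0 ≤ lambdaMin p t := by linarith
  -- If the noise is not small, the failed inequality itself bounds `ρ² λ_min`, and the truncation
  -- on the left suffices. Nothing about the estimator is needed then.
  by_cases hs₁ : 8 * Q₁ < κ₁ ^ 2 * lambdaMin p t * ρ ^ 2
  swap
  · exact ((mul_le_mul_of_nonneg_right (min_le_left _ _) hl0).trans
      (hdiv hκ₁ (not_lt.mp hs₁))).trans hb₁
  by_cases hs₂ : 8 * Q₂ < κ₂ ^ 2 * lambdaMin p t * ρ ^ 2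
  swap
  · exact ((mul_le_mul_of_nonneg_right (min_le_left _ _) hl0).trans
      (hdiv hκ₂ (not_lt.mp hs₂))).trans hb₂
  obtain ⟨a, ha, ha'⟩ := exists_score_eq_zero M.link₁.contDiff_link hκ₁ hρ d
    (fun i hi => hle₁ (p i) (hp i hi)) hl hs₁
  obtain ⟨b, hb, hb'⟩ := exists_score_eq_zero M.link₂.contDiff_link hκ₂ hρ
    (fun i => Real.log (c i)) (fun i hi => hle₂ (p i) (hp i hi)) hl hs₂
  -- Both equations now have roots, so the estimator solves them, and uniqueness identifies it with
  -- the roots near `β₀`.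
  obtain ⟨hm₁, hm₂⟩ := hβ ⟨(a, b), (quasiScore_eq_zero_iff M.link₁ M.σ₁_pos _ _ _ _).mpr ha,
    (quasiScore_eq_zero_iff M.link₂ M.σ₂_pos _ _ _ _).mpr hb⟩
  rw [quasiScore_eq_zero_iff M.link₁ M.σ₁_pos] at hm₁
  rw [quasiScore_eq_zero_iff M.link₂ M.σ₂_pos] at hm₂
  rw [← score_unique (strictMono_of_deriv_pos M.link₁.deriv_pos) (by linarith) hm₁ ha] at ha'
  rw [← score_unique (strictMono_of_deriv_pos M.link₂.deriv_pos) (by linarith) hm₂ hb] at hb'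
  refine (mul_le_mul_of_nonneg_right (min_le_right _ _) hl0).trans ?_
  rw [Prod.norm_def]
  rcases max_choice ‖(β - β₀).1‖ ‖(β - β₀).2‖ with h | h <;> rw [h]
  · exact (hdiv hκ₁ ha').trans hb₁
  · exact (hdiv hκ₂ hb').trans hb₂

/-! ### Conditional moments of the innovations -/

section Disintegration

variable {Ω E F : Type*} [MeasurableSpace Ω] [MeasurableSpace E] [MeasurableSpace F]
  {μ : Measure Ω} [IsFiniteMeasure μ] {X : Ω → E} {Y : Ω → F} {κ : Kernel E F} [IsMarkovKernel κ]

/-- Measurable rectangles determine a finite measure on a product. -/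
theorem map_prodMk_eq_compProd (hX : Measurable X) (hY : Measurable Y)
    (h : ∀ A : Set E, MeasurableSet A → ∀ B : Set F, MeasurableSet B →
      μ (X ⁻¹' A ∩ Y ⁻¹' B) = ∫⁻ ω in X ⁻¹' A, κ (X ω) B ∂μ) :
    μ.map (fun ω => (X ω, Y ω)) = (μ.map X) ⊗ₘ κ := by
  have : IsFiniteMeasure (μ.map X) := inferInstance
  refine Measure.ext_prod fun {A B} hA hB => ?_
  rw [Measure.compProd_apply_prod hA hB, Measure.map_apply (hX.prodMk hY) (hA.prod hB),
    setLIntegral_map hA (κ.measurable_coe hB) hX, ← h A hA B hB]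
  rfl

theorem lintegral_eq_lintegral_kernel (hX : Measurable X) (hY : Measurable Y)
    (h : μ.map (fun ω => (X ω, Y ω)) = (μ.map X) ⊗ₘ κ) {f : E × F → ENNReal}
    (hf : Measurable f) :
    ∫⁻ ω, f (X ω, Y ω) ∂μ = ∫⁻ ω, ∫⁻ z, f (X ω, z) ∂(κ (X ω)) ∂μ := by
  rw [← lintegral_map hf (hX.prodMk hY), h, Measure.lintegral_compProd hf,
    lintegral_map hf.lintegral_kernel_prod_right' hX]

theorem integral_eq_integral_kernel (hX : Measurable X) (hY : Measurable Y)
    (h : μ.map (fun ω => (X ω, Y ω)) = (μ.map X) ⊗ₘ κ) {f : E × F → ℝ} (hf : Measurable f)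
    (hfi : Integrable (fun ω => f (X ω, Y ω)) μ) :
    ∫ ω, f (X ω, Y ω) ∂μ = ∫ ω, ∫ z, f (X ω, z) ∂(κ (X ω)) ∂μ := by
  have hi : Integrable f ((μ.map X) ⊗ₘ κ) := by
    rw [← h]
    exact (integrable_map_measure hf.aestronglyMeasurable
      (hX.prodMk hY).aemeasurable).mpr hfi
  rw [← integral_map (φ := fun ω => (X ω, Y ω)) (hX.prodMk hY).aemeasurable
    hf.aestronglyMeasurable, h, Measure.integral_compProd hi, integral_map hX.aemeasurable]
  exact (hf.stronglyMeasurable.integral_kernel_prod_right').aestronglyMeasurable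

variable {ψ : F → ℝ} {m : E → ℝ} {s : ℝ}

theorem memLp_two_innovation (hX : Measurable X) (hY : Measurable Y)
    (h : μ.map (fun ω => (X ω, Y ω)) = (μ.map X) ⊗ₘ κ) (hψ : Measurable ψ) (hm : Measurable m)
    (hmem : ∀ x, MemLp ψ 2 (κ x)) (hmean : ∀ x, ∫ z, ψ z ∂(κ x) = m x)
    (hvar : ∀ x, variance ψ (κ x) ≤ s) :
    MemLp (fun ω => ψ (Y ω) - m (X ω)) 2 μ := by
  have hmeas : Measurable fun ω => ψ (Y ω) - m (X ω) := (hψ.comp hY).sub (hm.comp hX)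
  refine ⟨hmeas.aestronglyMeasurable, ?_⟩
  rw [eLpNorm_lt_top_iff_lintegral_rpow_enorm_lt_top (by norm_num) (by norm_num)]
  have hf : Measurable fun q : E × F => ‖ψ q.2 - m q.1‖ₑ ^ (2 : ENNReal).toReal := by fun_prop
  rw [lintegral_eq_lintegral_kernel hX hY h hf]
  have hin : ∀ x, ∫⁻ z, ‖ψ z - m x‖ₑ ^ (2 : ENNReal).toReal ∂(κ x) ≤ ENNReal.ofReal s := by
    intro x
    refine le_trans (le_of_eq ?_) (ENNReal.ofReal_le_ofReal (hvar x))
    rw [ofReal_variance (hmem x), evariance, hmean]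
    simp
  calc _ ≤ ∫⁻ _, ENNReal.ofReal s ∂μ := lintegral_mono fun ω => hin (X ω)
    _ < ⊤ := by
      rw [lintegral_const]
      exact ENNReal.mul_lt_top ENNReal.ofReal_lt_top (measure_lt_top _ _)

theorem integral_mul_innovation_eq_zero (hX : Measurable X) (hY : Measurable Y)
    (h : μ.map (fun ω => (X ω, Y ω)) = (μ.map X) ⊗ₘ κ) (hψ : Measurable ψ) (hm : Measurable m)
    (hmem : ∀ x, MemLp ψ 2 (κ x)) (hmean : ∀ x, ∫ z, ψ z ∂(κ x) = m x)
    (hvar : ∀ x, variance ψ (κ x) ≤ s) {W : E → ℝ} (hW : Measurable W)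
    (hWm : MemLp (fun ω => W (X ω)) 2 μ) :
    ∫ ω, W (X ω) * (ψ (Y ω) - m (X ω)) ∂μ = 0 := by
  have hf : Measurable fun q : E × F => W q.1 * (ψ q.2 - m q.1) := by fun_prop
  rw [integral_eq_integral_kernel hX hY h hf
    (hWm.integrable_mul (memLp_two_innovation hX hY h hψ hm hmem hmean hvar))]
  have hin : ∀ x, ∫ z, W x * (ψ z - m x) ∂(κ x) = 0 := fun x => by
    rw [integral_const_mul, integral_sub ((hmem x).integrable (by norm_num))
      (integrable_const _), hmean]
    simp
  simp [hin]

/-- Boundedness of `W` makes the product integrable although the innovation has only two moments. -/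
theorem integral_mul_innovation_sq_le (hX : Measurable X) (hY : Measurable Y)
    (h : μ.map (fun ω => (X ω, Y ω)) = (μ.map X) ⊗ₘ κ) (hψ : Measurable ψ) (hm : Measurable m)
    (hmem : ∀ x, MemLp ψ 2 (κ x)) (hmean : ∀ x, ∫ z, ψ z ∂(κ x) = m x)
    (hvar : ∀ x, variance ψ (κ x) ≤ s) {W : E → ℝ} (hW : Measurable W) (hW0 : ∀ x, 0 ≤ W x)
    {b : ℝ} (hWb : ∀ x, W x ≤ b) :
    Integrable (fun ω => W (X ω) * (ψ (Y ω) - m (X ω)) ^ 2) μ ∧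
    ∫ ω, W (X ω) * (ψ (Y ω) - m (X ω)) ^ 2 ∂μ ≤ s * ∫ ω, W (X ω) ∂μ := by
  have hf : Measurable fun q : E × F => W q.1 * (ψ q.2 - m q.1) ^ 2 := by fun_prop
  have hWX : Measurable fun ω => W (X ω) := hW.comp hX
  have hWbd : ∀ x, ‖W x‖ ≤ b := fun x => by
    rw [Real.norm_eq_abs, abs_of_nonneg (hW0 x)]
    exact hWb x
  have hint : Integrable (fun ω => W (X ω) * (ψ (Y ω) - m (X ω)) ^ 2) μ :=
    (memLp_two_innovation hX hY h hψ hm hmem hmean hvar).integrable_sq.bdd_mul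
      hWX.aestronglyMeasurable (ae_of_all _ fun ω => hWbd (X ω))
  refine ⟨hint, ?_⟩
  rw [integral_eq_integral_kernel hX hY h hf hint, ← integral_const_mul]
  have hin : ∀ x, ∫ z, W x * (ψ z - m x) ^ 2 ∂(κ x) = W x * variance ψ (κ x) := fun x => by
    rw [integral_const_mul, variance_eq_integral (hmem x).aemeasurable, hmean]
  simp only [hin]
  refine integral_mono_of_nonneg (ae_of_all _ fun ω => mul_nonneg (hW0 _) (variance_nonneg _ _))
    ((Integrable.of_bound hWX.aestronglyMeasurable b
      (ae_of_all _ fun ω => hWbd (X ω))).const_mul s) (ae_of_all _ fun ω => ?_)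
  dsimp only
  rw [mul_comm]
  exact mul_le_mul_of_nonneg_right (hvar _) (hW0 _)

end Disintegration

section Innovation

variable {Ω : Type*} [mΩ : MeasurableSpace Ω] {μ : Measure Ω} [IsProbabilityMeasure μ]
  {ℱ : Filtration ℕ mΩ} {M : Model} {β₀ : Param} {p d c : ℕ → Ω → ℝ}

theorem Model.IsNonAnticipating.innovation (hproc : M.IsNonAnticipating μ ℱ β₀ p d c)
    {h : ℝ → ℝ} (hh : Measurable h) {ψ : ℝ × ℝ → ℝ} (hψ : Measurable ψ) {θ : Fin 2 → ℝ} {s : ℝ}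
    (hmem : ∀ x ∈ M.prices, MemLp ψ 2 (M.law β₀ x))
    (hmean : ∀ x ∈ M.prices, ∫ z, ψ z ∂(M.law β₀ x) = h (priceVec x ⬝ᵥ θ))
    (hvar : ∀ x ∈ M.prices, variance ψ (M.law β₀ x) ≤ s) (t : ℕ) :
    MemLp (fun ω => ψ (d (t + 1) ω, c (t + 1) ω) - h (priceVec (p (t + 1) ω) ⬝ᵥ θ)) 2 μ ∧
    (∀ W : Ω → ℝ, Measurable[ℱ t] W → MemLp W 2 μ →
      ∫ ω, W ω * (ψ (d (t + 1) ω, c (t + 1) ω) - h (priceVec (p (t + 1) ω) ⬝ᵥ θ)) ∂μ = 0) ∧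
    (∀ W : Ω → ℝ, Measurable[ℱ t] W → (∀ ω, 0 ≤ W ω) → ∀ b, (∀ ω, W ω ≤ b) →
      Integrable (fun ω => W ω *
        (ψ (d (t + 1) ω, c (t + 1) ω) - h (priceVec (p (t + 1) ω) ⬝ᵥ θ)) ^ 2) μ ∧
      ∫ ω, W ω * (ψ (d (t + 1) ω, c (t + 1) ω) - h (priceVec (p (t + 1) ω) ⬝ᵥ θ)) ^ 2 ∂μ
        ≤ s * ∫ ω, W ω ∂μ) := by
  have := M.isMarkov β₀
  -- Conditioning on the past: `X` is the identity from `Ω` to `Ω` carrying the smaller σ-algebra `ℱ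
  -- t`, so functions of `X` are the `ℱ t`-measurable ones. The instances must therefore be
  -- explicit.
  let κ : @Kernel Ω (ℝ × ℝ) (ℱ t) _ :=
    @Kernel.comap ℝ (ℝ × ℝ) _ _ Ω (ℱ t) (M.law β₀) (p (t + 1)) (hproc.price_measurable t)
  have hκ : ∀ ω, κ ω = M.law β₀ (p (t + 1) ω) := fun ω => rfl
  have hMk : @IsMarkovKernel Ω (ℝ × ℝ) (ℱ t) _ κ := ⟨fun ω => by rw [hκ]; infer_instance⟩
  have hX : @Measurable Ω Ω mΩ (ℱ t) id := fun s hs => ℱ.le t s hs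
  have hY : Measurable fun ω => (d (t + 1) ω, c (t + 1) ω) :=
    (((hproc.demand_measurable t).mono (ℱ.le _) le_rfl).prodMk
      ((hproc.claims_measurable t).mono (ℱ.le _) le_rfl))
  have hmap := @map_prodMk_eq_compProd Ω Ω (ℝ × ℝ) mΩ (ℱ t) _ μ _ id
    (fun ω => (d (t + 1) ω, c (t + 1) ω)) κ hMk hX hY fun A hA B hB => hproc.condLaw t A hA B hB
  have hm : Measurable[ℱ t] fun ω => h (priceVec (p (t + 1) ω) ⬝ᵥ θ) := by
    simp only [priceVec_dotProduct]
    exact hh.comp (((hproc.price_measurable t).mul_const _).const_add _)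
  have h1 : ∀ ω, MemLp ψ 2 (κ ω) := fun ω => hmem _ (hproc.price_mem t ω)
  have h2 : ∀ ω, ∫ z, ψ z ∂(κ ω) = h (priceVec (p (t + 1) ω) ⬝ᵥ θ) :=
    fun ω => hmean _ (hproc.price_mem t ω)
  have h3 : ∀ ω, variance ψ (κ ω) ≤ s := fun ω => hvar _ (hproc.price_mem t ω)
  refine ⟨@memLp_two_innovation Ω Ω (ℝ × ℝ) mΩ (ℱ t) _ μ _ id _ κ hMk ψ _ s hX hY hmap hψ hm
      h1 h2 h3, fun W hW hWm => ?_, fun W hW hW0 b hWb => ?_⟩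
  · exact @integral_mul_innovation_eq_zero Ω Ω (ℝ × ℝ) mΩ (ℱ t) _ μ _ id _ κ hMk ψ _ s hX hY
      hmap hψ hm h1 h2 h3 W hW hWm
  · exact @integral_mul_innovation_sq_le Ω Ω (ℝ × ℝ) mΩ (ℱ t) _ μ _ id _ κ hMk ψ _ s hX hY
      hmap hψ hm h1 h2 h3 W hW hW0 b hWb

end Innovation

/-! ### Logarithmic growth of the self-normalized noise -/

theorem measurable_invForm {Ω : Type*} [MeasurableSpace Ω] {p : ℕ → Ω → ℝ} {t : ℕ}
    (hp : ∀ i ∈ Finset.Icc 1 t, Measurable (p i)) {s : Ω → Fin 2 → ℝ}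
    (hs : ∀ j, Measurable fun ω => s ω j) :
    Measurable fun ω => invForm (fun i => p i ω) t (s ω) := by
  have h1 : Measurable fun ω => ∑ i ∈ Finset.Icc 1 t, p i ω := Finset.measurable_fun_sum _ hp
  have h2 : Measurable fun ω => ∑ i ∈ Finset.Icc 1 t, p i ω ^ 2 :=
    Finset.measurable_fun_sum _ fun i hi => (hp i hi).pow_const 2
  have h3 := hs 0
  have h4 := hs 1
  unfold invForm
  fun_prop

theorem measurable_invBilin {Ω : Type*} [MeasurableSpace Ω] {p : ℕ → Ω → ℝ} {t : ℕ}
    (hp : ∀ i ∈ Finset.Icc 1 t, Measurable (p i)) {s r : Ω → Fin 2 → ℝ}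
    (hs : ∀ j, Measurable fun ω => s ω j) (hr : ∀ j, Measurable fun ω => r ω j) :
    Measurable fun ω => invBilin (fun i => p i ω) t (s ω) (r ω) := by
  have h1 : Measurable fun ω => ∑ i ∈ Finset.Icc 1 t, p i ω := Finset.measurable_fun_sum _ hp
  have h2 : Measurable fun ω => ∑ i ∈ Finset.Icc 1 t, p i ω ^ 2 :=
    Finset.measurable_fun_sum _ fun i hi => (hp i hi).pow_const 2
  have h3 := hs 0
  have h4 := hs 1
  have h5 := hr 0
  have h6 := hr 1
  unfold invBilin
  fun_prop

section NoiseBound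

variable {Ω : Type*} [mΩ : MeasurableSpace Ω] {μ : Measure Ω} [IsProbabilityMeasure μ]
  {ℱ : Filtration ℕ mΩ} {M : Model} {β₀ : Param} {p d c : ℕ → Ω → ℝ}

/-- The expected squared norm of the noise, weighted by the inverse of the regularized design
matrix, grows at most logarithmically. -/
theorem Model.IsNonAnticipating.integral_invForm_noise_le
    (hproc : M.IsNonAnticipating μ ℱ β₀ p d c)
    {h : ℝ → ℝ} (hh : Measurable h) {ψ : ℝ × ℝ → ℝ} (hψ : Measurable ψ) {θ : Fin 2 → ℝ} {s : ℝ}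
    (hs : 0 ≤ s) (hmem : ∀ x ∈ M.prices, MemLp ψ 2 (M.law β₀ x))
    (hmean : ∀ x ∈ M.prices, ∫ z, ψ z ∂(M.law β₀ x) = h (priceVec x ⬝ᵥ θ))
    (hvar : ∀ x ∈ M.prices, variance ψ (M.law β₀ x) ≤ s) (t : ℕ) :
    Integrable (fun ω => invForm (fun i => p i ω) t
      (noise h θ (fun i => p i ω) (fun i => ψ (d i ω, c i ω)) t)) μ ∧
    ∫ ω, invForm (fun i => p i ω) t
      (noise h θ (fun i => p i ω) (fun i => ψ (d i ω, c i ω)) t) ∂μ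
      ≤ s * Real.log (((1 + M.ph ^ 2) * (1 + t)) ^ 2) := by
  set S : ℕ → Ω → Fin 2 → ℝ := fun t ω =>
    noise h θ (fun i => p i ω) (fun i => ψ (d i ω, c i ω)) t with hSdef
  set ε : ℕ → Ω → ℝ := fun i ω => ψ (d i ω, c i ω) - h (priceVec (p i ω) ⬝ᵥ θ) with hε
  have hSsucc : ∀ t ω, S (t + 1) ω = S t ω + ε (t + 1) ω • priceVec (p (t + 1) ω) := by
    intro t ω
    simp only [hSdef, noise, hε]
    rw [Finset.sum_Icc_succ_top (by omega)]
  have hinn := hproc.innovation hh hψ hmem hmean hvar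
  -- Prices are known one step ahead, so `P_{t+1}` is already `ℱ t`-measurable. This makes both
  -- weights `w` and `B` below predictable.
  have hpm : ∀ t, ∀ i ∈ Finset.Icc 1 (t + 1), Measurable[ℱ t] (p i) := by
    intro t i hi
    rw [Finset.mem_Icc] at hi
    obtain ⟨j, rfl⟩ : ∃ j, i = j + 1 := ⟨i - 1, by omega⟩
    exact (hproc.price_measurable j).mono (ℱ.mono (by omega)) le_rfl
  have hpsq : ∀ t ω, p (t + 1) ω ^ 2 ≤ M.ph ^ 2 := fun t ω => by
    have := hproc.price_mem t ω
    exact pow_le_pow_left₀ (M.pl_pos.le.trans this.1) this.2 2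
  have hSm : ∀ t j, Measurable[ℱ t] fun ω => S t ω j := by
    intro t j
    simp only [hSdef, noise, Finset.sum_apply, Pi.smul_apply, smul_eq_mul]
    refine Finset.measurable_fun_sum _ fun i hi => ?_
    have hi' := Finset.mem_Icc.mp hi
    obtain ⟨k, rfl⟩ : ∃ k, i = k + 1 := ⟨i - 1, by omega⟩
    have hp : Measurable[ℱ t] (p (k + 1)) :=
      (hproc.price_measurable k).mono (ℱ.mono (by omega)) le_rfl
    have hd : Measurable[ℱ t] (d (k + 1)) :=
      (hproc.demand_measurable k).mono (ℱ.mono (by omega)) le_rfl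
    have hc : Measurable[ℱ t] (c (k + 1)) :=
      (hproc.claims_measurable k).mono (ℱ.mono (by omega)) le_rfl
    simp only [priceVec_dotProduct]
    refine ((hψ.comp (hd.prodMk hc)).sub (hh.comp ((hp.mul_const _).const_add _))).mul ?_
    fin_cases j
    · simp [priceVec]
    · simpa [priceVec] using hp
  have hxm : ∀ t j, Measurable[ℱ t] fun ω => priceVec (p (t + 1) ω) j := by
    intro t j
    fin_cases j
    · simp [priceVec]
    · simpa [priceVec] using hproc.price_measurable t
  have hxb : ∀ t ω, priceVec (p (t + 1) ω) 0 ^ 2 + priceVec (p (t + 1) ω) 1 ^ 2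
      ≤ 1 + M.ph ^ 2 := fun t ω => by
    simpa [priceVec] using hpsq t ω
  have hxj : ∀ t ω j, ‖priceVec (p (t + 1) ω) j‖ ≤ 1 + M.ph := by
    intro t ω j
    have := hproc.price_mem t ω
    have h0 := M.pl_pos.trans M.pl_lt_ph
    fin_cases j
    · simp [priceVec, h0.le]
    · have h1 := M.pl_pos.le.trans this.1
      have h2 := this.2
      simp only [priceVec]
      simp only [Fin.mk_one, Matrix.cons_val_one, Matrix.cons_val_fin_one, Real.norm_eq_abs]
      rw [abs_of_nonneg h1]
      linarith
  have hSL : ∀ t j, MemLp (fun ω => S t ω j) 2 μ := by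
    intro t j
    induction t with
    | zero => simp [hSdef, noise]
    | succ t ih =>
      simp only [hSsucc, Pi.add_apply, Pi.smul_apply, smul_eq_mul]
      refine ih.add ?_
      refine (hinn t).1.of_le_mul (c := 1 + M.ph) ?_ (ae_of_all _ fun ω => ?_)
      · exact (hinn t).1.aestronglyMeasurable.mul
          ((hxm t j).mono (ℱ.le t) le_rfl).aestronglyMeasurable
      · rw [norm_mul, mul_comm]
        exact mul_le_mul_of_nonneg_right (hxj t ω j) (norm_nonneg _)
  have hQm : ∀ t, Measurable fun ω => invForm (fun i => p i ω) t (S t ω) := fun t =>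
    measurable_invForm (fun i hi => (hpm t i (Finset.Icc_subset_Icc_right (by omega) hi)).mono
      (ℱ.le t) le_rfl) fun j => (hSm t j).mono (ℱ.le t) le_rfl
  have hSsq : ∀ t, Integrable (fun ω => S t ω 0 ^ 2 + S t ω 1 ^ 2) μ := fun t =>
    (hSL t 0).integrable_sq.add (hSL t 1).integrable_sq
  have hQi : ∀ t, Integrable (fun ω => invForm (fun i => p i ω) t (S t ω)) μ := fun t =>
    (hSsq t).mono' (hQm t).aestronglyMeasurable (ae_of_all _ fun ω => by
      rw [Real.norm_eq_abs, abs_of_nonneg (invForm_nonneg _ _ _)]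
      exact invForm_le _ _ _)
  have hlogb : ∀ t ω, Real.log (regDet (fun i => p i ω) t)
      ≤ Real.log (((1 + M.ph ^ 2) * (1 + t)) ^ 2) := fun t ω => by
    refine Real.log_le_log (by linarith [one_le_regDet (fun i => p i ω) t]) (regDet_le ?_ ?_)
    · intro i hi
      have hi' := Finset.mem_Icc.mp hi
      obtain ⟨k, rfl⟩ : ∃ k, i = k + 1 := ⟨i - 1, by omega⟩
      exact hpsq k ω
    · positivity
  have hlogm : ∀ t, Measurable fun ω => Real.log (regDet (fun i => p i ω) t) := by
    intro t
    have hp : ∀ i ∈ Finset.Icc 1 t, Measurable (p i) := fun i hi =>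
      (hpm t i (Finset.Icc_subset_Icc_right (by omega) hi)).mono (ℱ.le t) le_rfl
    have h1 : Measurable fun ω => ∑ i ∈ Finset.Icc 1 t, p i ω := Finset.measurable_fun_sum _ hp
    have h2 : Measurable fun ω => ∑ i ∈ Finset.Icc 1 t, p i ω ^ 2 :=
      Finset.measurable_fun_sum _ fun i hi => (hp i hi).pow_const 2
    unfold regDet
    fun_prop
  have hlogi : ∀ t, Integrable (fun ω => Real.log (regDet (fun i => p i ω) t)) μ := fun t =>
    Integrable.of_bound (hlogm t).aestronglyMeasurable _ (ae_of_all _ fun ω => by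
      rw [Real.norm_eq_abs, abs_of_nonneg (Real.log_nonneg (one_le_regDet _ _))]
      exact hlogb t ω)
  refine ⟨hQi t, ?_⟩
  have hmain : ∫ ω, invForm (fun i => p i ω) t (S t ω) ∂μ
      ≤ s * ∫ ω, Real.log (regDet (fun i => p i ω) t) ∂μ := by
    clear hlogb
    induction t with
    | zero => simp [hSdef, noise, regDet_zero, invForm]
    | succ t ih =>
      set x : Ω → Fin 2 → ℝ := fun ω => priceVec (p (t + 1) ω) with hx
      set w : Ω → ℝ := fun ω => invForm (fun i => p i ω) (t + 1) (x ω) with hw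
      set B : Ω → ℝ := fun ω => invBilin (fun i => p i ω) (t + 1) (S t ω) (x ω) with hB
      have hwm : Measurable[ℱ t] w :=
        @measurable_invForm Ω (ℱ t) p (t + 1) (hpm t) x (hxm t)
      have hBm : Measurable[ℱ t] B :=
        @measurable_invBilin Ω (ℱ t) p (t + 1) (hpm t) (S t) x (hSm t) (hxm t)
      have hw0 : ∀ ω, 0 ≤ w ω := fun ω => invForm_nonneg _ _ _
      have hwb : ∀ ω, w ω ≤ 1 + M.ph ^ 2 := fun ω => (invForm_le _ _ _).trans (hxb t ω)
      -- Cauchy–Schwarz and boundedness of prices give `B² ≤ (1 + ph²) |S_t|²`, and `S_t` is square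
      -- integrable.
      have hBL : MemLp B 2 μ := by
        rw [memLp_two_iff_integrable_sq (hBm.mono (ℱ.le t) le_rfl).aestronglyMeasurable]
        refine ((hSsq t).mul_const (1 + M.ph ^ 2)).mono'
          ((hBm.mono (ℱ.le t) le_rfl).pow_const 2).aestronglyMeasurable (ae_of_all _ fun ω => ?_)
        rw [Real.norm_eq_abs, abs_of_nonneg (sq_nonneg _)]
        exact (sq_invBilin_le _ _ _ _).trans
          (mul_le_mul (invForm_le _ _ _) (hwb ω) (hw0 ω) (by positivity))
      obtain ⟨hεL, hmart, hsq⟩ := hinn t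
      have hcross := hmart B hBm hBL
      obtain ⟨hwi, hwle⟩ := hsq w hwm hw0 _ hwb
      have hBi : Integrable (fun ω => B ω * ε (t + 1) ω) μ := hBL.integrable_mul hεL
      have hwi' : Integrable (fun ω => w ω * ε (t + 1) ω ^ 2) μ := hwi
      have hQB : Integrable (fun ω => invForm (fun i => p i ω) t (S t ω)
          + 2 * (B ω * ε (t + 1) ω)) μ := (hQi t).add (hBi.const_mul 2)
      have hwint : Integrable w μ := Integrable.of_bound
        (hwm.mono (ℱ.le t) le_rfl).aestronglyMeasurable (1 + M.ph ^ 2) (ae_of_all _ fun ω => by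
          rw [Real.norm_eq_abs, abs_of_nonneg (hw0 ω)]
          exact hwb ω)
      -- Expand the square in the metric of `P_{t+1}`, then go back to `P_t` in the `S_t` term only.
      -- The cross term integrates to zero.
      have hstep : ∀ ω, invForm (fun i => p i ω) (t + 1) (S (t + 1) ω)
          ≤ invForm (fun i => p i ω) t (S t ω) + (2 * (B ω * ε (t + 1) ω))
            + w ω * ε (t + 1) ω ^ 2 := fun ω => by
        rw [hSsucc, invForm_add_smul]
        gcongr
        exact invForm_succ_le _ _ _
      have hlogw : ∀ ω, w ω ≤ Real.log (regDet (fun i => p i ω) (t + 1))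
          - Real.log (regDet (fun i => p i ω) t) :=
        fun ω => invForm_priceVec_le_log (fun i => p i ω) t
      calc ∫ ω, invForm (fun i => p i ω) (t + 1) (S (t + 1) ω) ∂μ
          ≤ ∫ ω, (invForm (fun i => p i ω) t (S t ω) + (2 * (B ω * ε (t + 1) ω))
            + w ω * ε (t + 1) ω ^ 2) ∂μ :=
            integral_mono (hQi _) (hQB.add hwi') hstep
        _ = ∫ ω, invForm (fun i => p i ω) t (S t ω) ∂μ + 2 * ∫ ω, B ω * ε (t + 1) ω ∂μ
            + ∫ ω, w ω * ε (t + 1) ω ^ 2 ∂μ := by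
            rw [integral_add hQB hwi',
              integral_add (hQi t) (hBi.const_mul 2), integral_const_mul]
        _ ≤ s * ∫ ω, Real.log (regDet (fun i => p i ω) t) ∂μ + 2 * 0 + s * ∫ ω, w ω ∂μ := by
            rw [show ∫ ω, B ω * ε (t + 1) ω ∂μ = 0 from hcross]
            gcongr
        _ ≤ s * ∫ ω, Real.log (regDet (fun i => p i ω) t) ∂μ + 2 * 0
            + s * ∫ ω, (Real.log (regDet (fun i => p i ω) (t + 1))
              - Real.log (regDet (fun i => p i ω) t)) ∂μ := by
            gcongr
            · exact (hlogi _).sub (hlogi _)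
            · exact hlogw
        _ = s * ∫ ω, Real.log (regDet (fun i => p i ω) (t + 1)) ∂μ := by
            rw [integral_sub (hlogi _) (hlogi _)]
            ring
  refine hmain.trans (mul_le_mul_of_nonneg_left ?_ hs)
  calc _ ≤ ∫ _, Real.log (((1 + M.ph ^ 2) * (1 + t)) ^ 2) ∂μ :=
        integral_mono (hlogi t) (integrable_const _) (hlogb t)
    _ = _ := by simp

end NoiseBound

/-! ### Stability of the maximizer and quadratic loss -/

section Optimizer

variable {E : Type*} [NormedAddCommGroup E] {f : ℝ × E → ℝ} {a b : ℝ}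
  {V : Set E} {β₀ : E} {q : E → ℝ}

/-- A unique maximizer over a compact interval depends continuously on the parameter. -/
theorem tendsto_maximizer (hf : ContinuousOn f (Set.Icc a b ×ˢ V)) (hV : IsOpen V) (h₀ : β₀ ∈ V)
    (hq : ∀ β, q β ∈ Set.Icc a b)
    (hmax : ∀ β ∈ V, ∀ x ∈ Set.Icc a b, f (x, β) ≤ f (q β, β))
    (huniq : ∀ y ∈ Set.Icc a b, (∀ x ∈ Set.Icc a b, f (x, β₀) ≤ f (y, β₀)) → y = q β₀) :
    Tendsto q (𝓝 β₀) (𝓝 (q β₀)) := by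
  -- By compactness it suffices that each cluster point maximizes `f(·, β₀)`. This follows by
  -- passing to the limit in the maximality inequality along an ultrafilter.
  refine isCompact_Icc.tendsto_nhds_of_unique_mapClusterPt (Eventually.of_forall hq)
    fun y hy hcl => huniq y hy fun x hx => ?_
  obtain ⟨U, hU, hUy⟩ := mapClusterPt_iff_ultrafilter.mp hcl
  have hUV : ∀ᶠ β in (U : Filter E), β ∈ V := hU (hV.mem_nhds h₀)
  have hlim : ∀ (g : E → ℝ) (z : ℝ), (∀ β, g β ∈ Set.Icc a b) → z ∈ Set.Icc a b →
      Tendsto g U (𝓝 z) → Tendsto (fun β => f (g β, β)) U (𝓝 (f (z, β₀))) := by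
    intro g z hg hz hgz
    refine (hf (z, β₀) ⟨hz, h₀⟩).tendsto.comp (tendsto_nhdsWithin_iff.mpr ⟨?_, ?_⟩)
    · exact hgz.prodMk_nhds hU
    · filter_upwards [hUV] with β hβ using ⟨hg β, hβ⟩
  refine le_of_tendsto_of_tendsto (hlim (fun _ => x) x (fun _ => hx) hx tendsto_const_nhds)
    (hlim q y hq hy hUy) ?_
  filter_upwards [hUV] with β hβ using hmax β hβ x hx

variable [NormedSpace ℝ E]

/-- A nondegenerate unique maximizer over a compact interval is Lipschitz in the parameter. -/
theorem exists_lipschitz_maximizer (hab : a < b) (hf : ContDiffOn ℝ 2 f (Set.Icc a b ×ˢ V))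
    (hV : IsOpen V) (h₀ : β₀ ∈ V) (hq : ∀ β, q β ∈ Set.Icc a b)
    (hmax : ∀ β ∈ V, ∀ x ∈ Set.Icc a b, f (x, β) ≤ f (q β, β))
    (huniq : ∀ y ∈ Set.Icc a b, (∀ x ∈ Set.Icc a b, f (x, β₀) ≤ f (y, β₀)) → y = q β₀)
    (hfirst : derivWithin (fun x => f (x, β₀)) (Set.Icc a b) (q β₀) = 0)
    (hsecond : iteratedDerivWithin 2 (fun x => f (x, β₀)) (Set.Icc a b) (q β₀) < 0) :
    ∃ C > 0, ∃ ρ > 0, ∀ β, ‖β - β₀‖ < ρ → |q β - q β₀| ≤ C * ‖β - β₀‖ := by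
  set S := Set.Icc a b ×ˢ V with hS
  have hI : UniqueDiffOn ℝ (Set.Icc a b) := uniqueDiffOn_Icc hab
  have hSu : UniqueDiffOn ℝ S := hI.prod hV.uniqueDiffOn
  -- `g` is the price derivative. The maximizer may be an endpoint, where `g(q β, β) = 0` can fail,
  -- so a variational inequality replaces the implicit function theorem.
  set g : ℝ × E → ℝ := fun z => fderivWithin ℝ f S z (1, 0) with hg
  have hgC : ContDiffOn ℝ 1 g S :=
    (hf.fderivWithin hSu (by norm_num : (1 : WithTop ℕ∞) + 1 ≤ 2)).clm_apply contDiffOn_const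
  have hslice : ∀ (F : ℝ × E → ℝ), DifferentiableOn ℝ F S → ∀ x ∈ Set.Icc a b, ∀ β ∈ V,
      HasDerivWithinAt (fun x => F (x, β)) (fderivWithin ℝ F S (x, β) (1, 0)) (Set.Icc a b) x := by
    intro F hF x hx β hβ
    have h1 : HasDerivWithinAt (fun x : ℝ => (x, β)) ((1 : ℝ), (0 : E)) (Set.Icc a b) x :=
      ((hasDerivAt_id x).prodMk (hasDerivAt_const x β)).hasDerivWithinAt
    have h2 : HasFDerivWithinAt F (fderivWithin ℝ F S (x, β)) S (x, β) :=
      (hF (x, β) ⟨hx, hβ⟩).hasFDerivWithinAt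
    have hmaps : Set.MapsTo (fun x : ℝ => (x, β)) (Set.Icc a b) S := fun y hy => ⟨hy, hβ⟩
    exact h2.comp_hasDerivWithinAt x h1 hmaps
  have hfd := hslice f (hf.differentiableOn (by norm_num))
  have hgd := hslice g (hgC.differentiableOn (by norm_num))
  set z₀ : ℝ × E := (q β₀, β₀) with hz₀
  have hz₀S : z₀ ∈ S := ⟨hq β₀, h₀⟩
  set L := fderivWithin ℝ g S z₀ with hL
  have hg0 : g z₀ = 0 := by
    rw [← hfirst]
    exact ((hfd _ (hq β₀) _ h₀).derivWithin (hI _ (hq β₀))).symm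
  have hA : L (1, 0) < 0 := by
    refine lt_of_eq_of_lt ?_ hsecond
    rw [iteratedDerivWithin_succ, iteratedDerivWithin_one]
    have : Set.EqOn (derivWithin (fun x => f (x, β₀)) (Set.Icc a b)) (fun x => g (x, β₀))
        (Set.Icc a b) := fun x hx => (hfd x hx _ h₀).derivWithin (hI x hx)
    rw [derivWithin_congr this (this (hq β₀))]
    exact ((hgd _ (hq β₀) _ h₀).derivWithin (hI _ (hq β₀))).symm
  set m := -L (1, 0) with hm
  have hm0 : 0 < m := by linarith
  have hLc : ContinuousOn (fderivWithin ℝ g S) S := hgC.continuousOn_fderivWithin hSu (by norm_num)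
  obtain ⟨r₁, hr₁, hball⟩ := Metric.isOpen_iff.mp hV β₀ h₀
  obtain ⟨r₂, hr₂, hnear⟩ := Metric.continuousWithinAt_iff.mp (hLc z₀ hz₀S) (m / 2) (by linarith)
  set r := min r₁ r₂ with hr
  have hr0 : 0 < r := lt_min hr₁ hr₂
  set S' := (Set.Icc a b ×ˢ (Set.univ : Set E)) ∩ Metric.ball z₀ r with hS'
  have hS'conv : Convex ℝ S' := ((convex_Icc a b).prod convex_univ).inter (convex_ball _ _)
  have hS'S : S' ⊆ S := by
    rintro ⟨x, β⟩ ⟨⟨hx, -⟩, hz⟩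
    refine ⟨hx, hball ?_⟩
    rw [Metric.mem_ball, Prod.dist_eq, max_lt_iff] at hz
    exact Metric.mem_ball.mpr (hz.2.trans_le (min_le_left _ _))
  -- On a small convex neighbourhood the derivative of `g` is within `m/2` of `L`, so the
  -- linearization error is at most half of the curvature `m`.
  have hstrict : ∀ z ∈ S', ‖g z - g z₀ - L (z - z₀)‖ ≤ m / 2 * ‖z - z₀‖ := fun z hz =>
    Convex.norm_image_sub_le_of_norm_hasFDerivWithin_le'
      (fun x hx => ((hgC.differentiableOn (by norm_num)) x (hS'S hx)).hasFDerivWithinAt.mono hS'S)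
      (fun x hx => by
        have := hnear (hS'S hx) ((Metric.mem_ball.mp hx.2).trans_le (min_le_right _ _))
        rw [dist_eq_norm] at this
        exact this.le) hS'conv ⟨⟨hq β₀, trivial⟩, Metric.mem_ball_self hr0⟩ hz
  obtain ⟨r₃, hr₃, hq₃⟩ := Metric.tendsto_nhds_nhds.mp
    (tendsto_maximizer hf.continuousOn hV h₀ hq hmax huniq) r hr0
  set B := ‖L‖ with hB
  refine ⟨2 / m * (B + m / 2), by positivity, min r r₃, lt_min hr0 hr₃, fun β hβ => ?_⟩
  have hβr : ‖β - β₀‖ < r := hβ.trans_le (min_le_left _ _)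
  have hβV : β ∈ V := hball (by
    rw [Metric.mem_ball, dist_eq_norm]
    exact hβr.trans_le (min_le_left _ _))
  have hqr : dist (q β) (q β₀) < r := hq₃ (by
    rw [dist_eq_norm]
    exact hβ.trans_le (min_le_right _ _))
  have hzS' : (q β, β) ∈ S' := ⟨⟨hq β, trivial⟩, by
    rw [Metric.mem_ball, Prod.dist_eq, max_lt_iff]
    exact ⟨hqr, by rwa [dist_eq_norm]⟩⟩
  -- First-order condition: moving from the maximizer towards `q β₀`, a feasible direction, does not
  -- increase `f(·, β)` to first order.
  have hfoc : g (q β, β) * (q β₀ - q β) ≤ 0 := by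
    have hloc : IsLocalMaxOn (fun x => f (x, β)) (Set.Icc a b) (q β) :=
      IsMaxOn.localize fun x hx => hmax β hβV x hx
    have := hloc.hasFDerivWithinAt_nonpos (hfd _ (hq β) β hβV).hasFDerivWithinAt
      (sub_mem_posTangentConeAt_of_segment_subset
        ((convex_Icc a b).segment_subset (hq β) (hq β₀)))
    simpa [mul_comm] using this
  have hst := hstrict _ hzS'
  rw [hg0, sub_zero] at hst
  have hdec : (q β, β) - z₀ = (q β - q β₀) • ((1 : ℝ), (0 : E)) + ((0 : ℝ), β - β₀) := by
    simp [hz₀]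
  have hnorm : ‖(q β, β) - z₀‖ ≤ |q β - q β₀| + ‖β - β₀‖ := by
    rw [hz₀, Prod.mk_sub_mk, Prod.norm_mk, Real.norm_eq_abs]
    exact max_le_add_of_nonneg (abs_nonneg _) (norm_nonneg _)
  have hLb : |L ((0 : ℝ), β - β₀)| ≤ B * ‖β - β₀‖ := by
    have := L.le_opNorm ((0 : ℝ), β - β₀)
    simpa [Prod.norm_mk] using this
  have hLv : L ((q β, β) - z₀) = -m * (q β - q β₀) + L ((0 : ℝ), β - β₀) := by
    rw [hdec, map_add, map_smul, smul_eq_mul, hm]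
    ring
  rw [Real.norm_eq_abs, hLv] at hst
  set u := q β - q β₀ with hu
  set n := ‖β - β₀‖ with hn
  set l := L ((0 : ℝ), β - β₀)
  set γ := g (q β, β)
  have hst' : |γ - (-m * u + l)| ≤ m / 2 * (|u| + n) :=
    hst.trans (mul_le_mul_of_nonneg_left hnorm (by linarith))
  have hfoc' : 0 ≤ γ * u := by
    have : q β₀ - q β = -u := by rw [hu]; ring
    rw [this] at hfoc
    linarith
  -- `γu ≥ 0` while `γ ≈ -mu + l`, so `mu²` is bounded by the error terms. The part `(m/2)|u|²` is
  -- then absorbed on the left.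
  have key : m * u ^ 2 ≤ (B * n + m / 2 * (|u| + n)) * |u| := by
    have h1 : m * u ^ 2 ≤ (γ + m * u - l) * u + l * u := by nlinarith
    have h2 : (γ + m * u - l) * u ≤ m / 2 * (|u| + n) * |u| := by
      refine (le_abs_self _).trans ?_
      rw [abs_mul]
      refine mul_le_mul_of_nonneg_right (le_trans (le_of_eq ?_) hst') (abs_nonneg _)
      congr 1
      ring
    have h3 : l * u ≤ B * n * |u| := by
      refine (le_abs_self _).trans ?_
      rw [abs_mul]
      exact mul_le_mul_of_nonneg_right hLb (abs_nonneg _)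
    linarith
  rw [← sq_abs] at key
  have hn0 : 0 ≤ n := norm_nonneg _
  have hB0 : 0 ≤ B := norm_nonneg _
  rcases (abs_nonneg u).eq_or_lt with h0 | h0
  · rw [← h0]
    positivity
  · have : m / 2 * |u| ≤ (B + m / 2) * n := by
      have : (m / 2 * |u|) * |u| ≤ ((B + m / 2) * n) * |u| := by nlinarith
      exact le_of_mul_le_mul_right this h0
    rw [div_mul_eq_mul_div, div_mul_eq_mul_div, le_div_iff₀ hm0]
    linarith

end Optimizer

/-- A `C²` function on a compact interval deviates at most quadratically from its value at a
critical point. -/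
theorem exists_quadratic_bound {f : ℝ → ℝ} {a b x₀ : ℝ} (hab : a < b)
    (hf : ContDiffOn ℝ 2 f (Set.Icc a b)) (hx₀ : x₀ ∈ Set.Icc a b)
    (hfirst : derivWithin f (Set.Icc a b) x₀ = 0) :
    ∃ C, 0 ≤ C ∧ ∀ x ∈ Set.Icc a b, |f x₀ - f x| ≤ C * (x - x₀) ^ 2 := by
  have hI : UniqueDiffOn ℝ (Set.Icc a b) := uniqueDiffOn_Icc hab
  -- The derivative is Lipschitz and vanishes at `x₀`, so it is at most `K|x - x₀|` on the segment.
  -- The mean value inequality adds the second factor.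
  obtain ⟨K, hK⟩ := (hf.derivWithin hI (by norm_num : (1 : WithTop ℕ∞) + 1 ≤ 2)).exists_lipschitzOnWith
    (by norm_num) (convex_Icc a b) isCompact_Icc
  refine ⟨K, K.2, fun x hx => ?_⟩
  have hsub : segment ℝ x₀ x ⊆ Set.Icc a b := (convex_Icc a b).segment_subset hx₀ hx
  have hb : ∀ y ∈ segment ℝ x₀ x, ‖derivWithin f (Set.Icc a b) y‖ ≤ K * |x - x₀| := by
    intro y hy
    have := hK.dist_le_mul y (hsub hy) x₀ hx₀
    rw [hfirst, dist_zero_right, Real.dist_eq] at this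
    refine this.trans (mul_le_mul_of_nonneg_left ?_ K.2)
    simpa only [Real.norm_eq_abs] using norm_sub_le_of_mem_segment hy
  have := (convex_segment x₀ x).norm_image_sub_le_of_norm_hasDerivWithin_le
    (fun y hy => ((hf.differentiableOn (by norm_num)) y (hsub hy)).hasDerivWithinAt.mono hsub)
    hb (left_mem_segment ℝ x₀ x) (right_mem_segment ℝ x₀ x)
  rw [Real.norm_eq_abs, Real.norm_eq_abs] at this
  rw [abs_sub_comm, ← sq_abs (x - x₀)]
  linarith

/-! ### Asymptotics of the rate -/

theorem sum_one_div_sqrt_le (T : ℕ) :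
    ∑ t ∈ Finset.Icc 1 T, 1 / Real.sqrt t ≤ 2 * Real.sqrt T := by
  induction T with
  | zero => simp
  | succ n ih =>
    rw [Finset.sum_Icc_succ_top (by omega)]
    have h1 : (0 : ℝ) ≤ n := Nat.cast_nonneg n
    have hs : 0 < Real.sqrt ((n + 1 : ℕ) : ℝ) := Real.sqrt_pos.mpr (by positivity)
    have e1 := Real.sq_sqrt h1
    have e2 := Real.sq_sqrt (show (0 : ℝ) ≤ ((n + 1 : ℕ) : ℝ) by positivity)
    have : 1 / Real.sqrt ((n + 1 : ℕ) : ℝ)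
        ≤ 2 * Real.sqrt ((n + 1 : ℕ) : ℝ) - 2 * Real.sqrt n := by
      rw [div_le_iff₀ hs]
      push_cast at e2 ⊢
      nlinarith [sq_nonneg (Real.sqrt ((n : ℝ) + 1) - Real.sqrt n)]
    linarith

theorem L₁_nonneg {c : ℝ} (hc : 0 ≤ c) (t : ℕ) : 0 ≤ L₁ c t :=
  mul_nonneg hc (Real.sqrt_nonneg _)

theorem sum_log_div_L₁_nonneg {c : ℝ} (hc : 0 ≤ c) (T : ℕ) :
    0 ≤ ∑ t ∈ Finset.Icc 2 T, Real.log t / L₁ c t :=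
  Finset.sum_nonneg fun t _ => div_nonneg (Real.log_natCast_nonneg t) (L₁_nonneg hc t)

theorem sum_log_div_L₁_le {c : ℝ} (hc : 0 < c) (T : ℕ) :
    ∑ t ∈ Finset.Icc 2 T, Real.log t / L₁ c t ≤ 2 / c * Real.sqrt (T * Real.log T) := by
  -- The term equals `√(log t) / (c√t)`, and `log t` is replaced by `log T`.
  have hterm : ∀ t ∈ Finset.Icc 2 T, Real.log t / L₁ c t
      ≤ Real.sqrt (Real.log T) / c * (1 / Real.sqrt t) := by
    intro t ht
    obtain ⟨h2, hT⟩ := Finset.mem_Icc.mp ht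
    have ht1 : (1 : ℝ) < t := by exact_mod_cast h2
    have hlog : 0 < Real.log t := Real.log_pos ht1
    have hle : Real.sqrt (Real.log t) ≤ Real.sqrt (Real.log T) :=
      Real.sqrt_le_sqrt (Real.log_le_log (by linarith) (by exact_mod_cast hT))
    have hs := Real.sqrt_pos.mpr hlog
    have hst : 0 < Real.sqrt t := Real.sqrt_pos.mpr (by linarith)
    have : Real.log t / L₁ c t = Real.sqrt (Real.log t) / c * (1 / Real.sqrt t) := by
      rw [L₁, Real.sqrt_mul (by linarith)]
      field_simp
      rw [Real.sq_sqrt hlog.le]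
    rw [this]
    gcongr
  calc ∑ t ∈ Finset.Icc 2 T, Real.log t / L₁ c t
      ≤ ∑ t ∈ Finset.Icc 2 T, Real.sqrt (Real.log T) / c * (1 / Real.sqrt t) :=
        Finset.sum_le_sum hterm
    _ ≤ ∑ t ∈ Finset.Icc 1 T, Real.sqrt (Real.log T) / c * (1 / Real.sqrt t) :=
        Finset.sum_le_sum_of_subset_of_nonneg (Finset.Icc_subset_Icc_left (by omega))
          fun _ _ _ => by positivity
    _ = Real.sqrt (Real.log T) / c * ∑ t ∈ Finset.Icc 1 T, 1 / Real.sqrt t := by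
        rw [Finset.mul_sum]
    _ ≤ Real.sqrt (Real.log T) / c * (2 * Real.sqrt T) := by
        gcongr
        exact sum_one_div_sqrt_le T
    _ = _ := by
        rw [Real.sqrt_mul (Nat.cast_nonneg T)]
        ring

theorem rate_isTheta {c : ℝ} (hc : 0 < c) :
    (fun T : ℕ => L₁ c T + ∑ t ∈ Finset.Icc 2 T, Real.log t / L₁ c t) =Θ[atTop]
      (fun T : ℕ => Real.sqrt (T * Real.log T)) := by
  constructor
  · refine IsBigO.of_bound (c + 2 / c) (Eventually.of_forall fun T => ?_)
    rw [Real.norm_of_nonneg (add_nonneg (L₁_nonneg hc.le T) (sum_log_div_L₁_nonneg hc.le T)),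
      Real.norm_of_nonneg (Real.sqrt_nonneg _), add_mul]
    exact add_le_add le_rfl (sum_log_div_L₁_le hc T)
  · refine IsBigO.of_bound (1 / c) (Eventually.of_forall fun T => ?_)
    rw [Real.norm_of_nonneg (add_nonneg (L₁_nonneg hc.le T) (sum_log_div_L₁_nonneg hc.le T)),
      Real.norm_of_nonneg (Real.sqrt_nonneg _), one_div, inv_mul_eq_div, le_div_iff₀ hc, mul_comm]
    exact le_add_of_nonneg_right (sum_log_div_L₁_nonneg hc.le T)

theorem tendsto_L₁ {c : ℝ} (hc : 0 < c) : Tendsto (fun t : ℕ => L₁ c t) atTop atTop := by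
  refine (Real.tendsto_sqrt_atTop.comp ?_).const_mul_atTop hc
  exact tendsto_natCast_atTop_atTop.atTop_mul_atTop₀
    (Real.tendsto_log_atTop.comp tendsto_natCast_atTop_atTop)

theorem log_sq_mul_one_add_le {a : ℝ} (ha : 1 ≤ a) {t : ℕ} (ht : 2 ≤ t) :
    Real.log ((a * (1 + t)) ^ 2) ≤ (2 * (Real.log a / Real.log 2) + 4) * Real.log t := by
  have ht2 : (2 : ℝ) ≤ t := by exact_mod_cast ht
  have hl2 : 0 < Real.log 2 := Real.log_pos (by norm_num)
  -- `1 + t ≤ t²` for `t ≥ 2`.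
  have h1 : Real.log (1 + t) ≤ 2 * Real.log t := by
    rw [← Real.log_rpow (by linarith)]
    refine Real.log_le_log (by linarith) ?_
    norm_cast
    nlinarith
  have h2 : Real.log a ≤ Real.log a / Real.log 2 * Real.log t := by
    rw [div_mul_eq_mul_div, le_div_iff₀ hl2]
    exact mul_le_mul_of_nonneg_left (Real.log_le_log (by norm_num) ht2) (Real.log_nonneg ha)
  rw [Real.log_pow, Real.log_mul (by linarith) (by linarith)]
  push_cast
  linarith

/-! ### Noise and price errors in the pricing model -/

section NoiseGrowth

variable {Ω : Type*} [mΩ : MeasurableSpace Ω] {μ : Measure Ω} [IsProbabilityMeasure μ]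
  {ℱ : Filtration ℕ mΩ} {M : Model} {β₀ : Param} {p d c : ℕ → Ω → ℝ}

theorem Model.IsNonAnticipating.exists_noise_growth
    (hproc : M.IsNonAnticipating μ ℱ β₀ p d c) {h v : ℝ → ℝ} (hl : IsCanonicalLink h v)
    {ψ : ℝ × ℝ → ℝ} (hψ : Measurable ψ) {θ : Fin 2 → ℝ} {σ : ℝ}
    (hmom : ∀ x ∈ M.prices, HasGLMMoments h v σ (priceVec x ⬝ᵥ θ) ψ (M.law β₀ x)) :
    ∃ C, 0 ≤ C ∧ ∀ t,
      Integrable (fun ω => invForm (fun i => p i ω) t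
        (noise h θ (fun i => p i ω) (fun i => ψ (d i ω, c i ω)) t)) μ ∧
      (2 ≤ t → ∫ ω, invForm (fun i => p i ω) t
        (noise h θ (fun i => p i ω) (fun i => ψ (d i ω, c i ω)) t) ∂μ ≤ C * Real.log t) := by
  -- The variance is `σ² v(h(·)) = σ² h'(·)`, which is continuous in the price and hence bounded on
  -- the compact price interval.
  have hcont : Continuous fun x : ℝ => deriv h (priceVec x ⬝ᵥ θ) :=
    (hl.contDiff_link.continuous_deriv (by norm_num)).comp
      (continuous_priceVec_dotProduct.comp (Continuous.prodMk_left θ))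
  obtain ⟨B, hB⟩ := (isCompact_Icc (a := M.pl) (b := M.ph)).exists_bound_of_continuousOn
    hcont.continuousOn
  set s := σ ^ 2 * |B| with hs
  have hs0 : 0 ≤ s := by positivity
  have hmain := hproc.integral_invForm_noise_le hl.contDiff_link.continuous.measurable hψ hs0
    (fun x hx => (hmom x hx).memLp) (fun x hx => (hmom x hx).mean) fun x hx => by
      rw [(hmom x hx).variance, (hmom x hx).mean, ← hl.canonical]
      exact mul_le_mul_of_nonneg_left
        ((le_abs_self _).trans ((hB x hx).trans (le_abs_self B))) (sq_nonneg σ)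
  have ha : (1 : ℝ) ≤ 1 + M.ph ^ 2 := le_add_of_nonneg_right (sq_nonneg _)
  refine ⟨s * (2 * (Real.log (1 + M.ph ^ 2) / Real.log 2) + 4), ?_, fun t => ⟨(hmain t).1,
    fun ht => (hmain t).2.trans ?_⟩⟩
  · have := Real.log_nonneg ha
    have := Real.log_nonneg (show (1 : ℝ) ≤ 2 by norm_num)
    positivity
  · rw [mul_assoc s]
    exact mul_le_mul_of_nonneg_left (log_sq_mul_one_add_le ha ht) hs0

end NoiseGrowth

section Revenue

variable {M : Model} {V : Set Param} {β₀ : Param} {popt : Param → ℝ}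

theorem Model.RegularOptimum.contDiffOn_revenue (hopt : M.RegularOptimum V β₀ popt) :
    ContDiffOn ℝ 2 (fun x => M.revenue x β₀) (Set.Icc M.pl M.ph) := by
  have h1 : ContDiffOn ℝ 2 (fun x : ℝ => (x, β₀)) (Set.Icc M.pl M.ph) :=
    (contDiff_id.prodMk contDiff_const).contDiffOn
  exact hopt.contDiffOn.comp h1 fun x hx => ⟨hx, hopt.mem⟩

/-- The squared error of the certainty equivalent price is bounded by the truncated squared
estimation error. -/
theorem Model.RegularOptimum.exists_price_error_bound (hopt : M.RegularOptimum V β₀ popt) :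
    ∃ C > 0, ∃ ρ > 0, ∀ β, (popt β - popt β₀) ^ 2 ≤ C * min (ρ ^ 2) (‖β - β₀‖ ^ 2) := by
  obtain ⟨C, hC, ρ, hρ, hlip⟩ := exists_lipschitz_maximizer M.pl_lt_ph hopt.contDiffOn
    hopt.isOpen hopt.mem hopt.popt_mem (fun β hβ => (hopt.popt_optimal β hβ).2)
    (fun y hy hmax => hopt.popt_unique β₀ hopt.mem y ⟨hy, hmax⟩) hopt.first_order
    hopt.second_order
  refine ⟨C ^ 2 + (M.ph - M.pl) ^ 2 / ρ ^ 2, by positivity, ρ, hρ, fun β => ?_⟩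
  rcases lt_or_ge ‖β - β₀‖ ρ with h | h
  · rw [min_eq_right (pow_le_pow_left₀ (norm_nonneg _) h.le 2), ← sq_abs]
    calc |popt β - popt β₀| ^ 2 ≤ (C * ‖β - β₀‖) ^ 2 :=
          pow_le_pow_left₀ (abs_nonneg _) (hlip β h) 2
      _ = C ^ 2 * ‖β - β₀‖ ^ 2 := by ring
      _ ≤ _ := by
        gcongr
        exact le_add_of_nonneg_right (by positivity)
  -- Far from `β₀` only the length of the price interval bounds the error. The summand `(ph - pl)² /
  -- ρ²` of the constant pays for it.
  · rw [min_eq_left (pow_le_pow_left₀ hρ.le h 2), add_mul, div_mul_cancel₀ _ (by positivity)]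
    have h1 := hopt.popt_mem β
    have h2 := hopt.popt_mem β₀
    have : (popt β - popt β₀) ^ 2 ≤ (M.ph - M.pl) ^ 2 := by
      apply sq_le_sq'
      · linarith [h1.1, h2.2]
      · linarith [h1.2, h2.1]
    have : 0 ≤ C ^ 2 * ρ ^ 2 := by positivity
    linarith

end Revenue

theorem sq_sub_le_norm_priceVec_sub_sq (x y : ℝ) :
    (x - y) ^ 2 ≤ ‖priceVec x - priceVec y‖ ^ 2 := by
  rw [← sq_abs]
  have := norm_le_pi_norm (priceVec x - priceVec y) 1
  exact pow_le_pow_left₀ (abs_nonneg _) (by simpa [priceVec] using this) 2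

/-! ### Assembling the regret bound -/

section Regret

variable {Ω : Type*} [mΩ : MeasurableSpace Ω] {μ : Measure Ω} [IsProbabilityMeasure μ]
  {ℱ : Filtration ℕ mΩ} {M : Model} {V : Set Param} {β₀ : Param} {popt : Param → ℝ}
  {p d c : ℕ → Ω → ℝ}

theorem Model.IsNonAnticipating.integrable_regret (hproc : M.IsNonAnticipating μ ℱ β₀ p d c)
    (hopt : M.RegularOptimum V β₀ popt) (T : ℕ) :
    Integrable (fun ω => ∑ t ∈ Finset.Icc 1 T,
      (M.revenue (popt β₀) β₀ - M.revenue (p t ω) β₀)) μ := by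
  have hc := hopt.contDiffOn_revenue.continuousOn
  refine integrable_finsetSum _ fun t ht => (integrable_const _).sub ?_
  obtain ⟨k, rfl⟩ : ∃ k, t = k + 1 := ⟨t - 1, by have := (Finset.mem_Icc.mp ht).1; omega⟩
  -- The revenue is known to be continuous only on the price interval. A continuous extension to the
  -- line gives measurability along the prices.
  have hext : Continuous (Set.IccExtend M.pl_lt_ph.le
      (Set.domRestrict (Set.Icc M.pl M.ph) fun x => M.revenue x β₀)) :=
    (continuousOn_iff_continuous_domRestrict.mp hc).Icc_extend'
  have heq : (fun ω => M.revenue (p (k + 1) ω) β₀) = fun ω => Set.IccExtend M.pl_lt_ph.le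
      (Set.domRestrict (Set.Icc M.pl M.ph) fun x => M.revenue x β₀) (p (k + 1) ω) := by
    funext ω
    rw [Set.IccExtend_of_mem _ _ (hproc.price_mem k ω)]
    rfl
  obtain ⟨B, hB⟩ := isCompact_Icc.exists_bound_of_continuousOn hc
  refine Integrable.of_bound ?_ B (ae_of_all _ fun ω => hB _ (hproc.price_mem k ω))
  rw [heq]
  exact (hext.measurable.comp
    ((hproc.price_measurable k).mono (ℱ.le k) le_rfl)).aestronglyMeasurable

/-- The regret is controlled by the price dispersion and the estimation error. -/
theorem Model.IsNonAnticipating.exists_regret_bound (hproc : M.IsNonAnticipating μ ℱ β₀ p d c)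
    (hopt : M.RegularOptimum V β₀ popt) {βhat : ℕ → Ω → Param}
    (hβ : M.IsMQLESequence μ p d c βhat) {t₀ : ℕ} {c₁ : ℝ} (hc₁ : 0 < c₁) {K : ℝ}
    (hdisp : ∀ᵐ ω ∂μ, ∀ t, t₀ ≤ t → L₁ c₁ t ≤ lambdaMin (fun i => p i ω) t)
    (hprice : ∀ᵐ ω ∂μ, ∀ T, t₀ ≤ T →
      ∑ t ∈ Finset.Icc 1 T, ‖priceVec (p t ω) - priceVec (popt (βhat t ω))‖ ^ 2
        ≤ K * L₁ c₁ T) :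
    ∃ A, ∀ᶠ T in atTop, M.regret μ β₀ (popt β₀) p T ≤
      A * (L₁ c₁ T + ∑ t ∈ Finset.Icc 2 T, Real.log t / L₁ c₁ t) := by
  obtain ⟨Cr, hCr, hrev⟩ := exists_quadratic_bound M.pl_lt_ph hopt.contDiffOn_revenue
    (hopt.popt_mem β₀) hopt.first_order
  obtain ⟨Cp, hCp, ρ, hρ, hperr⟩ := hopt.exists_price_error_bound
  obtain ⟨Ce, hCe, herr⟩ := M.exists_mqle_error_bound β₀ hρ
  obtain ⟨C₁, hC₁, hQ₁⟩ := hproc.exists_noise_growth M.link₁ measurable_fst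
    (M.demand_moments β₀ (hopt.subset hopt.mem))
  obtain ⟨C₂, hC₂, hQ₂⟩ := hproc.exists_noise_growth M.link₂
    (Real.measurable_log.comp measurable_snd)
    (M.logClaims_moments β₀ (hopt.subset hopt.mem))
  set Q : ℕ → Ω → ℝ := fun t ω =>
    invForm (fun i => p i ω) t (noise M.h₁ β₀.1 (fun i => p i ω) (fun i => d i ω) t)
      + invForm (fun i => p i ω) t
        (noise M.h₂ β₀.2 (fun i => p i ω) (fun i => Real.log (c i ω)) t) with hQ
  have hQ0 : ∀ t ω, 0 ≤ Q t ω := fun t ω => add_nonneg (invForm_nonneg _ _ _) (invForm_nonneg _ _ _)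
  have hQi : ∀ t, Integrable (Q t) μ := fun t => (hQ₁ t).1.add (hQ₂ t).1
  have hQE : ∀ t, 2 ≤ t → ∫ ω, Q t ω ∂μ ≤ (C₁ + C₂) * Real.log t := fun t ht => by
    have := integral_add (hQ₁ t).1 (hQ₂ t).1
    have h1 := (hQ₁ t).2 ht
    have h2 := (hQ₂ t).2 ht
    refine (le_of_eq this).trans ?_
    rw [add_mul]
    exact add_le_add h1 h2
  obtain ⟨t₁, ht₁⟩ := eventually_atTop.mp ((tendsto_L₁ hc₁).eventually_ge_atTop 1)
  -- From `t₂` on, `λ_min ≥ L₁ ≥ 1`, as the error bound requires. Each earlier round costs at most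
  -- `b`.
  set t₂ := max (max t₀ t₁) 1 with ht₂
  set b := (M.ph - M.pl) ^ 2 with hb
  have hb0 : 0 ≤ b := sq_nonneg _
  set G : ℕ → ℝ := fun T => ∑ t ∈ Finset.Icc 2 T, Real.log t / L₁ c₁ t with hG
  have hpoint : ∀ᵐ ω ∂μ, ∀ t, 1 ≤ t → (popt (βhat t ω) - popt β₀) ^ 2 ≤
      (if t ∈ Finset.range t₂ then b else 0) + Cp * Ce * (Q t ω / L₁ c₁ t) := by
    filter_upwards [hβ, hdisp] with ω hω hωd t ht
    have hq : 0 ≤ Cp * Ce * (Q t ω / L₁ c₁ t) :=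
      mul_nonneg (mul_pos hCp hCe).le (div_nonneg (hQ0 t ω) (L₁_nonneg hc₁.le t))
    split_ifs with hlt
    · have h1 := hopt.popt_mem (βhat t ω)
      have h2 := hopt.popt_mem β₀
      have : (popt (βhat t ω) - popt β₀) ^ 2 ≤ b := by
        apply sq_le_sq'
        · linarith [h1.1, h2.2]
        · linarith [h1.2, h2.1]
      linarith
    · rw [Finset.mem_range, not_lt] at hlt
      have hL : 1 ≤ L₁ c₁ t := ht₁ t (by omega)
      have hlam := hωd t (by omega)
      have hpt : ∀ i ∈ Finset.Icc 1 t, p i ω ∈ M.prices := fun i hi => by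
        obtain ⟨k, rfl⟩ : ∃ k, i = k + 1 := ⟨i - 1, by have := (Finset.mem_Icc.mp hi).1; omega⟩
        exact hproc.price_mem k ω
      have he := herr (fun i => p i ω) (fun i => d i ω) (fun i => c i ω) t (βhat t ω) hpt
        (hL.trans hlam) (hω t ht)
      have he' : min (ρ ^ 2) (‖βhat t ω - β₀‖ ^ 2) ≤ Ce * (Q t ω / L₁ c₁ t) := by
        rw [← mul_div_assoc, le_div_iff₀ (by linarith)]
        exact (mul_le_mul_of_nonneg_left hlam (le_min (sq_nonneg _) (sq_nonneg _))).trans he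
      rw [zero_add, mul_assoc]
      exact (hperr _).trans (mul_le_mul_of_nonneg_left he' hCp.le)
  have hae : ∀ T, t₀ ≤ T → ∀ᵐ ω ∂μ,
      ∑ t ∈ Finset.Icc 1 T, (M.revenue (popt β₀) β₀ - M.revenue (p t ω) β₀)
        ≤ Cr * (2 * (K * L₁ c₁ T) + 2 * (t₂ * b
          + Cp * Ce * ∑ t ∈ Finset.Icc 1 T, Q t ω / L₁ c₁ t)) := by
    intro T hT
    filter_upwards [hpoint, hprice] with ω hω hωp
    have hind : ∑ t ∈ Finset.Icc 1 T, (if t ∈ Finset.range t₂ then b else 0) ≤ t₂ * b := by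
      rw [← Finset.sum_filter, Finset.sum_const, nsmul_eq_mul]
      refine mul_le_mul_of_nonneg_right ?_ hb0
      have : (Finset.filter (· ∈ Finset.range t₂) (Finset.Icc 1 T)).card
          ≤ (Finset.range t₂).card :=
        Finset.card_le_card fun i hi => (Finset.mem_filter.mp hi).2
      rw [Finset.card_range] at this
      exact_mod_cast this
    calc ∑ t ∈ Finset.Icc 1 T, (M.revenue (popt β₀) β₀ - M.revenue (p t ω) β₀)
        ≤ ∑ t ∈ Finset.Icc 1 T,
          Cr * (2 * ‖priceVec (p t ω) - priceVec (popt (βhat t ω))‖ ^ 2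
            + 2 * ((if t ∈ Finset.range t₂ then b else 0)
              + Cp * Ce * (Q t ω / L₁ c₁ t))) := by
          refine Finset.sum_le_sum fun t ht => ?_
          have ht1 := (Finset.mem_Icc.mp ht).1
          obtain ⟨k, rfl⟩ : ∃ k, t = k + 1 := ⟨t - 1, by omega⟩
          refine ((le_abs_self _).trans (hrev _ (hproc.price_mem k ω))).trans ?_
          refine mul_le_mul_of_nonneg_left ?_ hCr
          have h1 := sq_sub_le_norm_priceVec_sub_sq (p (k + 1) ω) (popt (βhat (k + 1) ω))
          have h2 := hω (k + 1) ht1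
          nlinarith [sq_nonneg ((p (k + 1) ω - popt (βhat (k + 1) ω))
            - (popt (βhat (k + 1) ω) - popt β₀))]
      _ = Cr * (2 * ∑ t ∈ Finset.Icc 1 T, ‖priceVec (p t ω) - priceVec (popt (βhat t ω))‖ ^ 2
            + 2 * (∑ t ∈ Finset.Icc 1 T, (if t ∈ Finset.range t₂ then b else 0)
              + Cp * Ce * ∑ t ∈ Finset.Icc 1 T, Q t ω / L₁ c₁ t)) := by
          rw [← Finset.mul_sum, Finset.sum_add_distrib, ← Finset.mul_sum, ← Finset.mul_sum,
            Finset.sum_add_distrib, ← Finset.mul_sum]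
      _ ≤ _ := by
          gcongr
          exact hωp T hT
  have hsumE : ∀ T, ∑ t ∈ Finset.Icc 1 T, (∫ ω, Q t ω ∂μ) / L₁ c₁ t ≤ (C₁ + C₂) * G T := by
    intro T
    rw [hG, Finset.mul_sum]
    have hsplit : ∑ t ∈ Finset.Icc 1 T, (∫ ω, Q t ω ∂μ) / L₁ c₁ t
        = ∑ t ∈ Finset.Icc 2 T, (∫ ω, Q t ω ∂μ) / L₁ c₁ t := by
      refine (Finset.sum_subset (Finset.Icc_subset_Icc_left (by omega)) fun t ht hnt => ?_).symm
      -- At `t = 1` the denominator `L₁` is zero, and division by zero gives zero.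
      have : t = 1 := by
        rw [Finset.mem_Icc] at ht hnt
        omega
      simp [this, L₁]
    rw [hsplit]
    refine Finset.sum_le_sum fun t ht => ?_
    rw [← mul_div_assoc]
    exact div_le_div_of_nonneg_right (hQE t (Finset.mem_Icc.mp ht).1) (L₁_nonneg hc₁.le t)
  refine ⟨2 * Cr * (|K| + t₂ * b + Cp * Ce * (C₁ + C₂)), ?_⟩
  filter_upwards [eventually_ge_atTop (max t₀ t₁)] with T hT
  have hL : 1 ≤ L₁ c₁ T := ht₁ T ((le_max_right _ _).trans hT)
  have hsumi : Integrable (fun ω => ∑ t ∈ Finset.Icc 1 T, Q t ω / L₁ c₁ t) μ :=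
    integrable_finsetSum _ fun t _ => (hQi t).div_const _
  have hi₁ : Integrable (fun ω => t₂ * b + Cp * Ce * ∑ t ∈ Finset.Icc 1 T, Q t ω / L₁ c₁ t) μ :=
    (integrable_const _).add (hsumi.const_mul (Cp * Ce))
  have hi₂ : Integrable (fun ω => 2 * (K * L₁ c₁ T) + 2 * (t₂ * b
      + Cp * Ce * ∑ t ∈ Finset.Icc 1 T, Q t ω / L₁ c₁ t)) μ :=
    (integrable_const _).add (hi₁.const_mul 2)
  have hG0 : 0 ≤ G T := sum_log_div_L₁_nonneg hc₁.le T
  calc M.regret μ β₀ (popt β₀) p T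
      ≤ ∫ ω, Cr * (2 * (K * L₁ c₁ T) + 2 * (t₂ * b
          + Cp * Ce * ∑ t ∈ Finset.Icc 1 T, Q t ω / L₁ c₁ t)) ∂μ :=
        integral_mono_ae (hproc.integrable_regret hopt T)
          (hi₂.const_mul Cr) (hae T ((le_max_left _ _).trans hT))
    _ = Cr * (2 * (K * L₁ c₁ T) + 2 * (t₂ * b
          + Cp * Ce * ∑ t ∈ Finset.Icc 1 T, (∫ ω, Q t ω ∂μ) / L₁ c₁ t)) := by
        rw [integral_const_mul, integral_add (integrable_const _) (hi₁.const_mul 2),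
          integral_const_mul 2 (fun ω => t₂ * b + Cp * Ce * ∑ t ∈ Finset.Icc 1 T, Q t ω / L₁ c₁ t),
          integral_add (integrable_const _) (hsumi.const_mul (Cp * Ce)),
          integral_const_mul (Cp * Ce), integral_finsetSum _ fun t _ => (hQi t).div_const _]
        simp [integral_div]
    _ ≤ Cr * (2 * (|K| * L₁ c₁ T) + 2 * (t₂ * b * L₁ c₁ T
          + Cp * Ce * ((C₁ + C₂) * G T))) := by
        have hK : K * L₁ c₁ T ≤ |K| * L₁ c₁ T :=
          mul_le_mul_of_nonneg_right (le_abs_self K) (by linarith)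
        -- The cost of the initial rounds is absorbed into `L₁(T) ≥ 1`.
        have hb' : t₂ * b ≤ t₂ * b * L₁ c₁ T := le_mul_of_one_le_right (by positivity) hL
        have hE := mul_le_mul_of_nonneg_left (hsumE T) (mul_pos hCp hCe).le
        exact mul_le_mul_of_nonneg_left (by linarith) hCr
    _ ≤ 2 * Cr * (|K| + t₂ * b + Cp * Ce * (C₁ + C₂)) * (L₁ c₁ T + G T) := by
        have e1 : 0 ≤ Cr * (|K| + t₂ * b) * G T := by positivity
        have e2 : 0 ≤ Cr * (Cp * Ce * (C₁ + C₂)) * L₁ c₁ T := by positivity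
        nlinarith

end Regret

end GLMPricing

end

theorem theorem1 {Ω : Type*} [mΩ : MeasurableSpace Ω] (μ : Measure Ω) [IsProbabilityMeasure μ]
    (ℱ : Filtration ℕ mΩ) (M : GLMPricing.Model)
    (V : Set GLMPricing.Param) (β₀ : GLMPricing.Param) (popt : GLMPricing.Param → ℝ)
    (hopt : M.RegularOptimum V β₀ popt)
    (p d c : ℕ → Ω → ℝ) (hproc : M.IsNonAnticipating μ ℱ β₀ p d c)
    (βhat : ℕ → Ω → GLMPricing.Param) (hβ : M.IsMQLESequence μ p d c βhat)
    (hcons : M.StronglyConsistent μ p d c βhat β₀)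
    (t₀ : ℕ) (c₁ : ℝ) (hc₁ : 0 < c₁) (K : ℝ)
    (hdisp : ∀ᵐ ω ∂μ, ∀ t, t₀ ≤ t →
      GLMPricing.L₁ c₁ t ≤ GLMPricing.lambdaMin (fun i => p i ω) t)
    (hprice : ∀ᵐ ω ∂μ, ∀ T, t₀ ≤ T →
      ∑ t ∈ Finset.Icc 1 T,
        ‖GLMPricing.priceVec (p t ω) - GLMPricing.priceVec (popt (βhat t ω))‖ ^ 2
        ≤ K * GLMPricing.L₁ c₁ T) :
    (∀ T, Integrable (fun ω => ∑ t ∈ Finset.Icc 1 T,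
        (M.revenue (popt β₀) β₀ - M.revenue (p t ω) β₀)) μ) ∧
    (fun T => M.regret μ β₀ (popt β₀) p T) =O[atTop]
      (fun T : ℕ => GLMPricing.L₁ c₁ T
        + ∑ t ∈ Finset.Icc 2 T, Real.log t / GLMPricing.L₁ c₁ t) ∧
    (fun T : ℕ => GLMPricing.L₁ c₁ T
        + ∑ t ∈ Finset.Icc 2 T, Real.log t / GLMPricing.L₁ c₁ t) =Θ[atTop]
      (fun T : ℕ => Real.sqrt (T * Real.log T)) ∧
    (fun T => M.regret μ β₀ (popt β₀) p T) =O[atTop]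
      (fun T : ℕ => Real.sqrt (T * Real.log T)) := by
  have hreg := hproc.integrable_regret hopt
  have hΘ := GLMPricing.rate_isTheta hc₁
  have hO : (fun T => M.regret μ β₀ (popt β₀) p T) =O[atTop]
      (fun T : ℕ => GLMPricing.L₁ c₁ T
        + ∑ t ∈ Finset.Icc 2 T, Real.log t / GLMPricing.L₁ c₁ t) := by
    obtain ⟨A, hA⟩ := hproc.exists_regret_bound hopt hβ hc₁ hdisp hprice
    refine IsBigO.of_bound A ?_
    filter_upwards [hA] with T hT
    -- Optimality of `popt β₀` makes the regret nonnegative, so the upper bound is a bound on its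
    -- norm.
    have hnonneg : 0 ≤ M.regret μ β₀ (popt β₀) p T :=
      integral_nonneg fun ω => Finset.sum_nonneg fun t ht => by
        obtain ⟨k, rfl⟩ : ∃ k, t = k + 1 :=
          ⟨t - 1, by have := (Finset.mem_Icc.mp ht).1; omega⟩
        exact sub_nonneg.mpr ((hopt.popt_optimal β₀ hopt.mem).2 _ (hproc.price_mem k ω))
    rwa [Real.norm_of_nonneg hnonneg, Real.norm_of_nonneg (add_nonneg
      (GLMPricing.L₁_nonneg hc₁.le T) (GLMPricing.sum_log_div_L₁_nonneg hc₁.le T))]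
  exact ⟨hreg, hO, hΘ, hO.trans hΘ.isBigO⟩
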